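/- For every $n \ge 1$ let $k = k_n \ge 2$ (number of clusters) and $d = d_n \ge 1$ (dimension) be integers, $z^* = z^*_n \in [k]^n$ a vector of true labels, $\mu_a = \mu_a^{(n)} \in \mathbb{R}^d$ locations and $\sigma_a = \sigma_a^{(n)} \in (0,\infty)^d$ scales ($a \in [k]$), where $\sigma_{\min} \le \sigma_{a\ell} \le \sigma_{\max}$ for all $n, a, \ell$, with constants $0 < \sigma_{\min} \le \sigma_{\max} < \infty$ independent of $n$. The data $X_1, \dots, X_n \in \mathbb{R}^d$ are $X_{i\ell} = \mu_{z_i^*\ell} + \sigma_{z_i^*\ell}\,\epsilon_{i\ell}$ with $\epsilon_{i\ell}$ ($i \in [n], \ell \in [d]$) independent standard Laplace variables (density $\tfrac12 e^{-|x|}$). For $\mu \in \mathbb{R}^d$ and $\sigma \in (0,\infty)^d$ let $f_{(\mu,\sigma)}(x) = \prod_{\ell=1}^d \frac{1}{2\sigma_\ell} e^{-|x_\ell - \mu_\ell|/\sigma_\ell}$, and put $$\Delta_{\mu,\infty} = \max_{a \ne b} \|\mu_a - \mu_b\|_\infty, \qquad \mathrm{Chernoff}(\mathcal F) = \min_{a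 \ne b} \Big( -\log \inf_{t \in (0,1)} \int_{\mathbb{R}^d} f_{(\mu_a,\sigma_a)}^{t}(x)\, f_{(\mu_b,\sigma_b)}^{1-t}(x)\, dx \Big),$$ and $\mathrm{loss}(z, z') = \min_{\tau \in \mathrm{Sym}(k)} \#\{ i \in [n] : z_i \ne \tau(z'_i) \}$ for $z, z' \in [k]^n$. Iterative algorithm: from a labelling $\hat z^{(t-1)} \in [k]^n$, compute for each cluster $a$ and each coordinate $\ell$ the sample mean $\hat\mu^{(t)}_{a\ell}$ of the $X_{i\ell}$ with $\hat z^{(t-1)}_i = a$, and their mean absolute deviation $\hat\sigma^{(t)}_{a\ell}$ from that sample mean (the average of $|X_{i\ell} - \hat\mu^{(t)}_{a\ell}|$ over these $i$); then let $\hat z_i^{(t)} \in \arg\max_{a \in [k]} \log f_{(\hat\mu^{(t)}_a, \hat\sigma^{(t)}_a)}(X_i)$ for every $i \in [n]$. Ties are broken arbitrarily, and the update is arbitrary if some $\hat\sigma^{(t)}_{a\ell}$ vanishes or some cluster is empty. Theorem. All asymptotic notations refer to $n \to \infty$. Suppose that $k \log^2(dk) = o(n)$; that for some $\alpha > 0$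 independent of $n$ and all large $n$, $\min_{a \in [k]} \#\{i \in [n] : z_i^* = a\} \ge \alpha n k^{-1}$; that $\Delta_{\mu,\infty} = O\big(d^{-1}\,\mathrm{Chernoff}(\mathcal F)\big)$; and that $d\sqrt{k}\,\Big(1 + \frac{\Delta_{\mu,\infty}}{\sqrt{n k^{-1}}}\Big) = o\big(\mathrm{Chernoff}(\mathcal F)\big)$. Let $\hat z^{(0)}, \hat z^{(1)}, \dots$ be produced by the algorithm from an initialisation $\hat z^{(0)}$, possibly random and dependent on the data, with $\mathrm{loss}(z^*, \hat z^{(0)}) = o\big(n k^{-1} \Delta_{\mu,\infty}^{-1}\big)$ in probability. Then, for every constant $c > 0$, there is a deterministic sequence $\varepsilon_n \to 0$ such that, with probability $1 - o(1)$, $$ n^{-1}\,\mathrm{loss}(z^*, \hat z^{(t)}) \le e^{-(1+\varepsilon_n)\,\mathrm{Chernoff}(\mathcal F)} \quad \text{for all integers } t \ge \lfloor c \log n \rfloor . $$ -/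

import Mathlib

open Filter Topology MeasureTheory ProbabilityTheory Asymptotics

noncomputable section

namespace LaplaceMixture

/-- The density `x ↦ (2σ)⁻¹ exp (-|x - m| / σ)` of the Laplace distribution on `ℝ` with location
`m` and scale `σ > 0`. -/
def laplacePDF (m σ x : ℝ) : ℝ := (2 * σ)⁻¹ * Real.exp (-(|x - m| / σ))

/-- The Laplace distribution `Lap(m, σ)` on `ℝ`. -/
def laplaceMeasure (m σ : ℝ) : Measure ℝ :=
  volume.withDensity fun x => ENNReal.ofReal (laplacePDF m σ x)

/-- The density on `ℝ^d` of a vector with independent coordinates, the `l`-th of them distributed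
as `Lap(m l, σ l)`. -/
def laplaceVecPDF {d : ℕ} (m σ : Fin d → ℝ) (x : Fin d → ℝ) : ℝ :=
  ∏ l, laplacePDF (m l) (σ l) (x l)

/-- The data `X i l` (point `i`, coordinate `l`) follow the coordinate-wise Laplace location-scale
mixture model with true labels `z`, locations `μ a` and scales `σ a`:
`X i l = μ (z i) l + σ (z i) l * ε i l` with all `ε i l` independent and `Lap(0, 1)`. -/
def IsLaplaceMixture {Ω : Type*} [MeasurableSpace Ω] {n k d : ℕ} (P : Measure Ω)
    (z : Fin n → Fin k) (μ σ : Fin k → Fin d → ℝ) (X : Ω → Fin n → Fin d → ℝ) : Prop :=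
  ∃ ε : Fin n × Fin d → Ω → ℝ,
    iIndepFun ε P ∧ (∀ p, HasLaw (ε p) (laplaceMeasure 0 1) P) ∧
      ∀ ω i l, X ω i l = μ (z i) l + σ (z i) l * ε (i, l) ω

/-- The Chernoff information `-log inf_{t ∈ (0,1)} ∫ f^t g^(1-t) dν` of two densities. -/
def chernoff {E : Type*} [MeasurableSpace E] (ν : Measure E) (f g : E → ℝ) : ℝ :=
  -Real.log (⨅ t : Set.Ioo (0 : ℝ) 1, ∫ x, f x ^ (t : ℝ) * g x ^ (1 - (t : ℝ)) ∂ν)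

/-- The Chernoff information of the family of Laplace densities with locations `μ a` and scales
`σ a`: the minimum of the Chernoff information over the pairs of distinct clusters. -/
def chernoffFamily {k d : ℕ} (μ σ : Fin k → Fin d → ℝ) : ℝ :=
  ⨅ p : {p : Fin k × Fin k // p.1 ≠ p.2},
    chernoff volume (laplaceVecPDF (μ p.1.1) (σ p.1.1)) (laplaceVecPDF (μ p.1.2) (σ p.1.2))

/-- `Δ_{μ,∞}`, the maximal sup-norm distance between two cluster centres. (The norm of
`Fin d → ℝ` is the sup norm.) -/
def maxSep {k d : ℕ} (μ : Fin k → Fin d → ℝ) : ℝ :=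
  ⨆ p : {p : Fin k × Fin k // p.1 ≠ p.2}, ‖μ p.1.1 - μ p.1.2‖

/-- The number of disagreements of two labellings, minimised over permutations of the labels. -/
def loss {n k : ℕ} (z z' : Fin n → Fin k) : ℕ :=
  ⨅ τ : Equiv.Perm (Fin k), hammingDist z (τ ∘ z')

/-- The number of points with label `a`. -/
def clusterSize {n k : ℕ} (z : Fin n → Fin k) (a : Fin k) : ℕ :=
  (Finset.univ.filter fun i => z i = a).card

/-- The estimated location of cluster `a` in coordinate `l`: the sample mean over the points
labelled `a`. -/
def estLoc {n k d : ℕ} (x : Fin n → Fin d → ℝ) (z : Fin n → Fin k) (a : Fin k) (l : Fin d) : ℝ :=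
  (clusterSize z a : ℝ)⁻¹ * ∑ i with z i = a, x i l

/-- The estimated scale of cluster `a` in coordinate `l`: the mean absolute deviation from the
sample mean over the points labelled `a`. -/
def estScale {n k d : ℕ} (x : Fin n → Fin d → ℝ) (z : Fin n → Fin k) (a : Fin k) (l : Fin d) : ℝ :=
  (clusterSize z a : ℝ)⁻¹ * ∑ i with z i = a, |x i l - estLoc x z a l|

/-- `z'` is a possible outcome of one iteration from `z`: every point is assigned to a cluster that
maximises its log-likelihood under the parameters estimated from `z`. Ties may be broken in any
way. If some estimated scale vanishes (for instance if a cluster is empty), the estimates do not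
parametrise Laplace distributions, and then nothing is required of `z'`. -/
def IsStep {n k d : ℕ} (x : Fin n → Fin d → ℝ) (z z' : Fin n → Fin k) : Prop :=
  (∀ a l, 0 < estScale x z a l) →
    ∀ i b, Real.log (laplaceVecPDF (estLoc x z b) (estScale x z b) (x i)) ≤
      Real.log (laplaceVecPDF (estLoc x z (z' i)) (estScale x z (z' i)) (x i))

/-- `zhat 0, zhat 1, …` are the successive labellings of a run of the iterative algorithm on the
data `x`, started at `zhat 0`. -/
def IsRun {n k d : ℕ} (x : Fin n → Fin d → ℝ) (zhat : ℕ → Fin n → Fin k) : Prop :=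
  ∀ t, IsStep x (zhat t) (zhat (t + 1))

end LaplaceMixture

end

namespace LaplaceMixture

/-! A single iteration from a good start already reaches the Chernoff rate, because constant
accuracy of the estimates is enough. Write C for the Chernoff information of the family and D for
the maximal separation. If all locations and scales are known up to r, the log-likelihoods of a
point change by at most r times a multiple of d + dD + ∑ |ε|. Here d = o(C), dD = O(C), and ∑ |ε| <
2(C + d) outside an event of probability at most exp(-C), so the change is at most a multiple of rC.
A small constant r therefore costs only a fraction η of the exponent.

The dependence between labels and data is removed deterministically. On an event about the noise
alone (`GoodNoise`), every labelling with few errors yields accurate estimates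
(`GoodNoise.abs_est_sub_le`). A point misclassified in the next step must then be a `BadPoint`, a
property of its own noise that does not mention the labelling (`badPoint_of_isStep`). By Chernoff's
bound and Markov's inequality there are at most n exp(-(1-η)C) bad points with high probability.
This is few enough to serve as a new initialisation, so one event controls every t ≥ 1
(`GoodNoise.hammingDist_run_le`, `measure_not_loss_le`).

Mislabelled points may carry large noise, so the noise is cut at a level s of order log k. The bound
C ≤ d (const + D / σmin) forces D to exceed every multiple of √k, hence s + 1 ≤ D, and an initial
loss of order o(n / (kD)) suffices. Finally η is sent to zero along a diagonal sequence. -/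

/-! ### The Laplace law: normalisation, moments, sub-exponential bounds -/

lemma laplacePDF_pos {m σ : ℝ} (hσ : 0 < σ) (x : ℝ) : 0 < laplacePDF m σ x := by
  unfold laplacePDF; positivity

lemma continuous_laplacePDF (m σ : ℝ) : Continuous (laplacePDF m σ) := by
  unfold laplacePDF; fun_prop

lemma laplacePDF_affine {m σ : ℝ} (hσ : 0 < σ) (x : ℝ) :
    σ * laplacePDF m σ (m + σ * x) = laplacePDF 0 1 x := by
  unfold laplacePDF
  have h1 : |m + σ * x - m| / σ = |x| := by
    rw [add_sub_cancel_left, abs_mul, abs_of_pos hσ]; field_simp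
  rw [h1]; simp; field_simp

/-- Standardising an integral against the Laplace density. -/
lemma integral_affine_mul_laplacePDF {m σ : ℝ} (hσ : 0 < σ) (g : ℝ → ℝ) :
    ∫ x, laplacePDF 0 1 x * g (m + σ * x) = ∫ y, laplacePDF m σ y * g y := by
  simp_rw [← laplacePDF_affine (m := m) hσ, mul_assoc]
  rw [integral_const_mul,
    Measure.integral_comp_mul_left (fun x => laplacePDF m σ (m + x) * g (m + x)) σ,
    integral_add_left_eq_self (fun x => laplacePDF m σ x * g x) m, abs_of_pos (inv_pos.2 hσ),
    smul_eq_mul, ← mul_assoc, mul_inv_cancel₀ hσ.ne', one_mul]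

lemma integrable_affine_mul_laplacePDF {m σ : ℝ} (hσ : 0 < σ) {g : ℝ → ℝ}
    (hg : Integrable fun y => laplacePDF m σ y * g y) :
    Integrable fun x => laplacePDF 0 1 x * g (m + σ * x) := by
  have := ((hg.comp_add_left m).comp_mul_left' hσ.ne').const_mul σ
  refine this.congr (ae_of_all _ fun x => ?_)
  simp only [← laplacePDF_affine (m := m) hσ, mul_assoc]

lemma integral_exp_neg_mul_abs {a : ℝ} (ha : 0 < a) : ∫ x : ℝ, Real.exp (-a * |x|) = 2 / a := by
  rw [integral_comp_abs (f := fun x => Real.exp (-a * x)), integral_exp_mul_Ioi (by linarith)]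
  simp [div_eq_mul_inv]

lemma integrable_exp_neg_mul_abs {a : ℝ} (ha : 0 < a) :
    Integrable fun x : ℝ => Real.exp (-a * |x|) := by
  by_contra h
  have := integral_undef h
  rw [integral_exp_neg_mul_abs ha] at this
  exact (by positivity : 2 / a ≠ 0) this

lemma laplacePDF_std (x : ℝ) : laplacePDF 0 1 x = 2⁻¹ * Real.exp (-1 * |x|) := by
  simp [laplacePDF]

lemma integrable_laplacePDF_std : Integrable (laplacePDF 0 1) := by
  simpa only [← laplacePDF_std] using
    (integrable_exp_neg_mul_abs one_pos).const_mul 2⁻¹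

lemma integral_laplacePDF_std : ∫ x, laplacePDF 0 1 x = 1 := by
  simp_rw [laplacePDF_std]
  rw [integral_const_mul, integral_exp_neg_mul_abs one_pos]; norm_num

lemma integral_laplacePDF {m σ : ℝ} (hσ : 0 < σ) : ∫ x, laplacePDF m σ x = 1 := by
  have := integral_affine_mul_laplacePDF (m := m) hσ fun _ => 1
  simpa [integral_laplacePDF_std] using this.symm

lemma integrable_laplacePDF {m σ : ℝ} (hσ : 0 < σ) : Integrable (laplacePDF m σ) := by
  by_contra h
  have := integral_undef h
  rw [integral_laplacePDF hσ] at this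
  exact one_ne_zero this

lemma laplacePDF_mul_exp (x : ℝ) :
    laplacePDF 0 1 x * Real.exp (|x| / 2) = 2⁻¹ * Real.exp (-(1/2) * |x|) := by
  rw [laplacePDF_std, mul_assoc, ← Real.exp_add]; ring_nf

instance : IsProbabilityMeasure (laplaceMeasure 0 1) where
  measure_univ := by
    rw [laplaceMeasure, withDensity_apply _ .univ, Measure.restrict_univ,
      ← ofReal_integral_eq_lintegral_ofReal integrable_laplacePDF_std
        (ae_of_all _ fun x => (laplacePDF_pos one_pos x).le), integral_laplacePDF_std]
    simp

lemma integral_laplaceMeasure (g : ℝ → ℝ) :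
    ∫ x, g x ∂laplaceMeasure 0 1 = ∫ x, laplacePDF 0 1 x * g x := by
  rw [laplaceMeasure, integral_withDensity_eq_integral_toReal_smul
    (continuous_laplacePDF 0 1).measurable.ennreal_ofReal (by simp)]
  refine integral_congr_ae (ae_of_all _ fun x => ?_)
  simp [ENNReal.toReal_ofReal (laplacePDF_pos one_pos x).le]

lemma integrable_laplaceMeasure_iff {g : ℝ → ℝ} :
    Integrable g (laplaceMeasure 0 1) ↔ Integrable fun x => laplacePDF 0 1 x * g x := by
  rw [laplaceMeasure, integrable_withDensity_iff_integrable_smul'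
    (continuous_laplacePDF 0 1).measurable.ennreal_ofReal (by simp)]
  refine integrable_congr (ae_of_all _ fun x => ?_)
  simp [ENNReal.toReal_ofReal (laplacePDF_pos one_pos x).le]

lemma integrable_exp_half_abs :
    Integrable (fun x => Real.exp (|x| / 2)) (laplaceMeasure 0 1) := by
  rw [integrable_laplaceMeasure_iff]
  simp_rw [laplacePDF_mul_exp]
  exact (integrable_exp_neg_mul_abs (by norm_num)).const_mul _

/-- Half of the critical rate keeps the exponential moment finite, with the convenient value 2. All
tail bounds for the noise below rest on this one moment. -/
lemma integral_exp_half_abs : ∫ x, Real.exp (|x| / 2) ∂laplaceMeasure 0 1 = 2 := by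
  rw [integral_laplaceMeasure]
  simp_rw [laplacePDF_mul_exp]
  rw [integral_const_mul, integral_exp_neg_mul_abs (by norm_num)]; norm_num

lemma integrable_abs_laplaceMeasure : Integrable (fun x => |x|) (laplaceMeasure 0 1) := by
  refine (integrable_exp_half_abs.const_mul 2).mono (by fun_prop) (ae_of_all _ fun x => ?_)
  rw [Real.norm_eq_abs, Real.norm_eq_abs, abs_abs,
    abs_of_pos (mul_pos two_pos (Real.exp_pos (|x| / 2)))]
  have := Real.add_one_le_exp (|x| / 2)
  linarith

lemma integral_id_laplaceMeasure : ∫ x, x ∂laplaceMeasure 0 1 = 0 := by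
  rw [integral_laplaceMeasure]
  have h := integral_neg_eq_self (fun x : ℝ => laplacePDF 0 1 x * x) volume
  have h2 : ∀ x : ℝ, laplacePDF 0 1 (-x) * (-x) = -(laplacePDF 0 1 x * x) := fun x => by
    simp [laplacePDF_std]
  simp_rw [h2, integral_neg] at h
  linarith

lemma integral_abs_laplaceMeasure : ∫ x, |x| ∂laplaceMeasure 0 1 = 1 := by
  rw [integral_laplaceMeasure]
  simp_rw [laplacePDF_std]
  rw [integral_comp_abs (f := fun x => 2⁻¹ * Real.exp (-1 * x) * x)]
  have h := Real.integral_rpow_mul_exp_neg_mul_Ioi (a := 2) (r := 1) (by norm_num) one_pos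
  have h2 : ∫ x in Set.Ioi (0 : ℝ), 2⁻¹ * Real.exp (-1 * x) * x =
      2⁻¹ * ∫ x in Set.Ioi (0 : ℝ), x ^ ((2 : ℝ) - 1) * Real.exp (-(1 * x)) := by
    rw [← integral_const_mul]
    refine integral_congr_ae (ae_of_all _ fun x => ?_)
    norm_num; ring
  rw [h2, h]; norm_num [Real.Gamma_two]

lemma exp_le_one_add_add_sq_mul_exp_abs (y : ℝ) :
    Real.exp y ≤ 1 + y + y ^ 2 * Real.exp |y| := by
  have := Complex.norm_exp_sub_sum_le_norm_mul_exp (y : ℂ) 2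
  simp only [Finset.sum_range_succ, Finset.sum_range_zero] at this
  norm_num at this
  rw [← Complex.ofReal_exp, ← Complex.ofReal_one, ← Complex.ofReal_add, ← Complex.ofReal_sub,
    Complex.norm_real, Real.norm_eq_abs] at this
  linarith [le_of_abs_le this]

/-- A function of a standard Laplace variable that grows at most linearly and has mean zero is
sub-exponential. -/
lemma mgf_laplaceMeasure_le {Y : ℝ → ℝ} (hY : Measurable Y) (hYb : ∀ x, |Y x| ≤ |x| + 1)
    (hY0 : ∫ x, Y x ∂laplaceMeasure 0 1 = 0) {r : ℝ} (hr0 : 0 ≤ r) (hr : r ≤ 1 / 4) :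
    Integrable (fun x => Real.exp (r * Y x)) (laplaceMeasure 0 1) ∧
      ∫ x, Real.exp (r * Y x) ∂laplaceMeasure 0 1 ≤ Real.exp (128 * r ^ 2) := by
  have hhalf : Real.exp (1 / 2) ≤ 2 := by
    have h1 := Real.exp_one_lt_d9
    have h2 : Real.exp (1 / 2) ^ 2 = Real.exp 1 := by rw [← Real.exp_nat_mul]; norm_num
    nlinarith [Real.exp_pos (1 / 2)]
  have hYi : Integrable Y (laplaceMeasure 0 1) :=
    (integrable_abs_laplaceMeasure.add (integrable_const (1 : ℝ))).mono hY.aestronglyMeasurable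
      (ae_of_all _ fun x => by
        simp only [Real.norm_eq_abs, Pi.add_apply]
        rw [abs_of_nonneg (by positivity : 0 ≤ |x| + 1)]; exact hYb x)
  -- The square is absorbed by one factor exp(|Y|/4), and r ≤ 1/4 bounds the Taylor remainder by
  -- another; together they stay below the integrable exp(|x|/2). The linear term integrates to
  -- zero, and 128 = 64 * 2.
  have hpt : ∀ x, Real.exp (r * Y x) ≤ 1 + r * Y x + 64 * r ^ 2 * Real.exp (|x| / 2) := by
    intro x
    have h1 := exp_le_one_add_add_sq_mul_exp_abs (r * Y x)
    have h2 : Y x ^ 2 ≤ 32 * Real.exp (|Y x| / 4) := by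
      have := Real.quadratic_le_exp_of_nonneg (x := |Y x| / 4) (by positivity)
      nlinarith [sq_abs (Y x), abs_nonneg (Y x)]
    have h3 : Real.exp |r * Y x| ≤ Real.exp (|Y x| / 4) := by
      rw [abs_mul, abs_of_nonneg hr0]
      apply Real.exp_le_exp.2
      nlinarith [abs_nonneg (Y x)]
    have h4 : Real.exp (|Y x| / 4) * Real.exp (|Y x| / 4) ≤ 2 * Real.exp (|x| / 2) := by
      rw [← Real.exp_add]
      calc Real.exp (|Y x| / 4 + |Y x| / 4) ≤ Real.exp (1 / 2 + |x| / 2) :=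
            Real.exp_le_exp.2 (by linarith [hYb x])
        _ = Real.exp (1 / 2) * Real.exp (|x| / 2) := Real.exp_add _ _
        _ ≤ _ := by gcongr
    have h5 : (r * Y x) ^ 2 * Real.exp |r * Y x| ≤
        r ^ 2 * (32 * Real.exp (|Y x| / 4)) * Real.exp (|Y x| / 4) := by
      rw [mul_pow]; gcongr
    have h6 : r ^ 2 * (32 * Real.exp (|Y x| / 4)) * Real.exp (|Y x| / 4) ≤
        64 * r ^ 2 * Real.exp (|x| / 2) := by
      nlinarith [mul_le_mul_of_nonneg_left h4 (by positivity : 0 ≤ 32 * r ^ 2)]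
    linarith
  have hbi : Integrable (fun x => 1 + r * Y x + 64 * r ^ 2 * Real.exp (|x| / 2))
      (laplaceMeasure 0 1) :=
    ((integrable_const _).add (hYi.const_mul r)).add (integrable_exp_half_abs.const_mul _)
  have hint : Integrable (fun x => Real.exp (r * Y x)) (laplaceMeasure 0 1) :=
    hbi.mono (by fun_prop) (ae_of_all _ fun x => by
      rw [Real.norm_eq_abs, Real.norm_eq_abs, abs_of_pos (Real.exp_pos _)]
      exact (hpt x).trans (le_abs_self _))
  refine ⟨hint, (integral_mono hint hbi hpt).trans ?_⟩
  have hYr : Integrable (fun x => 1 + r * Y x) (laplaceMeasure 0 1) :=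
    (integrable_const _).add (hYi.const_mul r)
  rw [integral_add hYr (integrable_exp_half_abs.const_mul _),
    integral_add (integrable_const _) (hYi.const_mul r),
    integral_const_mul, integral_const_mul, hY0, integral_exp_half_abs]
  have := Real.add_one_le_exp (128 * r ^ 2)
  simp only [integral_const, probReal_univ, smul_eq_mul]
  linarith

/-! ### Exponential Markov inequality and Chernoff's bound -/

/-- The exponential Markov inequality for sums of functions of independent variables. -/
lemma measureReal_le_sum_comp_le {Ω ι : Type*} [MeasurableSpace Ω] [Fintype ι] {P : Measure Ω}
    [IsProbabilityMeasure P] {L : Measure ℝ} [IsProbabilityMeasure L] {ε : ι → Ω → ℝ}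
    (hε : iIndepFun ε P) (hlaw : ∀ i, HasLaw (ε i) L P) {g : ι → ℝ → ℝ}
    (hg : ∀ i, Measurable (g i)) (S : Finset ι)
    (hint : ∀ i ∈ S, Integrable (fun x => Real.exp (g i x)) L) (u : ℝ) :
    P.real {ω | u ≤ ∑ i ∈ S, g i (ε i ω)} ≤
      Real.exp (-u) * ∏ i ∈ S, ∫ x, Real.exp (g i x) ∂L := by
  classical
  have hpi := hε.hasLaw_pi hlaw
  have hmeas : Measurable fun y : ι → ℝ => ∑ i ∈ S, g i (y i) := by fun_prop
  have h1 : P.real {ω | u ≤ ∑ i ∈ S, g i (ε i ω)} =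
      (Measure.pi fun _ : ι => L).real {y | u ≤ ∑ i ∈ S, g i (y i)} :=
    hpi.measureReal_eq (measurableSet_le measurable_const hmeas)
  -- Padding with factors 1 outside `S` gives a product over all indices, to which Fubini for the
  -- product measure applies.
  have hprod : ∀ y : ι → ℝ, Real.exp (1 * ∑ i ∈ S, g i (y i)) =
      ∏ i, if i ∈ S then Real.exp (g i (y i)) else 1 := fun y => by
    rw [one_mul, Real.exp_sum, Finset.prod_ite_mem, Finset.univ_inter]
  have hI : Integrable (fun y : ι → ℝ => Real.exp (1 * ∑ i ∈ S, g i (y i)))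
      (Measure.pi fun _ : ι => L) := by
    simp_rw [hprod]
    refine Integrable.fintype_prod_dep
      (f := fun i x => if i ∈ S then Real.exp (g i x) else 1) fun i => ?_
    by_cases hi : i ∈ S
    · simpa [hi] using hint i hi
    · simp [hi]
  rw [h1]
  refine (measure_ge_le_exp_mul_mgf u zero_le_one hI).trans (le_of_eq ?_)
  rw [mgf, neg_one_mul]
  simp_rw [hprod]
  rw [integral_fintype_prod_eq_prod (fun i x => if i ∈ S then Real.exp (g i x) else 1)]
  congr 1
  rw [← Finset.univ_inter S, ← Finset.prod_ite_mem]
  simp only [Finset.univ_inter]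
  refine Finset.prod_congr rfl fun i _ => ?_
  split_ifs <;> simp

lemma log_laplacePDF {m σ : ℝ} (hσ : 0 < σ) (x : ℝ) :
    Real.log (laplacePDF m σ x) = -Real.log (2 * σ) - |x - m| / σ := by
  rw [laplacePDF, Real.log_mul (by positivity) (Real.exp_ne_zero _), Real.log_inv, Real.log_exp]
  ring

lemma log_laplaceVecPDF {d : ℕ} {m σ : Fin d → ℝ} (hσ : ∀ l, 0 < σ l) (x : Fin d → ℝ) :
    Real.log (laplaceVecPDF m σ x) = ∑ l, Real.log (laplacePDF (m l) (σ l) (x l)) :=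
  Real.log_prod fun l _ => (laplacePDF_pos (hσ l) _).ne'

/-- By weighted AM-GM the integrand is dominated by a convex combination of the two densities. -/
lemma integrable_laplacePDF_rpow_mul {m σ m' σ' t : ℝ} (hσ : 0 < σ) (hσ' : 0 < σ')
    (ht : t ∈ Set.Ioo (0 : ℝ) 1) :
    Integrable fun x => laplacePDF m σ x ^ t * laplacePDF m' σ' x ^ (1 - t) := by
  have hc : Continuous fun x => laplacePDF m σ x ^ t * laplacePDF m' σ' x ^ (1 - t) :=
    ((continuous_laplacePDF m σ).rpow_const fun x => Or.inr ht.1.le).mul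
      ((continuous_laplacePDF m' σ').rpow_const fun x => Or.inr (by linarith [ht.2]))
  refine (((integrable_laplacePDF hσ (m := m)).const_mul t).add
    ((integrable_laplacePDF hσ' (m := m')).const_mul (1 - t))).mono hc.aestronglyMeasurable
    (ae_of_all _ fun x => ?_)
  have h1 := (laplacePDF_pos (m := m) hσ x).le
  have h2 := (laplacePDF_pos (m := m') hσ' x).le
  simp only [Real.norm_eq_abs, Pi.add_apply]
  rw [abs_of_nonneg (by positivity)]
  exact (Real.geom_mean_le_arith_mean2_weighted ht.1.le (by linarith [ht.2]) h1 h2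
    (by ring)).trans (le_abs_self _)

lemma integral_laplaceVecPDF_rpow_mul {d : ℕ} {m σ m' σ' : Fin d → ℝ} (hσ : ∀ l, 0 < σ l)
    (hσ' : ∀ l, 0 < σ' l) (t : ℝ) :
    ∫ x, laplaceVecPDF m σ x ^ t * laplaceVecPDF m' σ' x ^ (1 - t) =
      ∏ l, ∫ x, laplacePDF (m l) (σ l) x ^ t * laplacePDF (m' l) (σ' l) x ^ (1 - t) := by
  rw [← integral_fintype_prod_volume_eq_prod
    (fun l x => laplacePDF (m l) (σ l) x ^ t * laplacePDF (m' l) (σ' l) x ^ (1 - t))]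
  refine integral_congr_ae (ae_of_all _ fun x => ?_)
  simp only [laplaceVecPDF]
  rw [Finset.prod_mul_distrib, Real.finsetProd_rpow _ _ fun l _ => (laplacePDF_pos (hσ l) _).le,
    Real.finsetProd_rpow _ _ fun l _ => (laplacePDF_pos (hσ' l) _).le]

lemma laplacePDF_mul_exp_log_ratio {m σ m' σ' : ℝ} (hσ : 0 < σ) (hσ' : 0 < σ') (t x : ℝ) :
    laplacePDF m' σ' x *
        Real.exp (t * (Real.log (laplacePDF m σ x) - Real.log (laplacePDF m' σ' x))) =
      laplacePDF m σ x ^ t * laplacePDF m' σ' x ^ (1 - t) := by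
  have h1 := laplacePDF_pos (m := m) hσ x
  have h2 := laplacePDF_pos (m := m') hσ' x
  rw [Real.rpow_def_of_pos h1, Real.rpow_def_of_pos h2, ← Real.exp_add]
  nth_rw 1 [← Real.exp_log h2]
  rw [← Real.exp_add]; ring_nf

/-- Under the second density, the moment generating function of the log-likelihood ratio at t is
exactly the Chernoff integral. The margin costs exp(tu) ≤ exp(u), uniformly in t, so that the
infimum over t can be taken afterwards. -/
lemma measureReal_le_log_ratio_le {Ω : Type*} [MeasurableSpace Ω] {d : ℕ} {P : Measure Ω}
    [IsProbabilityMeasure P] {ε : Fin d → Ω → ℝ} (hε : iIndepFun ε P)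
    (hlaw : ∀ l, HasLaw (ε l) (laplaceMeasure 0 1) P) {m σ m' σ' : Fin d → ℝ}
    (hσ : ∀ l, 0 < σ l) (hσ' : ∀ l, 0 < σ' l) {u t : ℝ} (hu : 0 ≤ u)
    (ht : t ∈ Set.Ioo (0 : ℝ) 1) :
    P.real {ω | -u ≤ Real.log (laplaceVecPDF m σ fun l => m' l + σ' l * ε l ω) -
        Real.log (laplaceVecPDF m' σ' fun l => m' l + σ' l * ε l ω)} ≤
      Real.exp u * ∫ x, laplaceVecPDF m σ x ^ t * laplaceVecPDF m' σ' x ^ (1 - t) := by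
  set r : Fin d → ℝ → ℝ := fun l y =>
    t * (Real.log (laplacePDF (m l) (σ l) y) - Real.log (laplacePDF (m' l) (σ' l) y)) with hr
  have hrm : ∀ l, Measurable (r l) := fun l =>
    (((continuous_laplacePDF _ _).measurable.log).sub
      ((continuous_laplacePDF _ _).measurable.log)).const_mul t
  have hI : ∀ l, Integrable (fun x => Real.exp (r l (m' l + σ' l * x))) (laplaceMeasure 0 1) := by
    intro l
    rw [integrable_laplaceMeasure_iff]
    refine integrable_affine_mul_laplacePDF (g := fun y => Real.exp (r l y)) (hσ' l) ?_
    simp_rw [hr, laplacePDF_mul_exp_log_ratio (hσ l) (hσ' l)]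
    exact integrable_laplacePDF_rpow_mul (hσ l) (hσ' l) ht
  have key := measureReal_le_sum_comp_le hε hlaw (g := fun l x => r l (m' l + σ' l * x))
    (fun l => (hrm l).comp (by fun_prop)) Finset.univ (fun l _ => hI l) (-(t * u))
  have hE : ∀ l, ∫ x, Real.exp (r l (m' l + σ' l * x)) ∂laplaceMeasure 0 1 =
      ∫ x, laplacePDF (m l) (σ l) x ^ t * laplacePDF (m' l) (σ' l) x ^ (1 - t) := by
    intro l
    rw [integral_laplaceMeasure,
      integral_affine_mul_laplacePDF (hσ' l) (fun y => Real.exp (r l y))]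
    simp_rw [hr, laplacePDF_mul_exp_log_ratio (hσ l) (hσ' l)]
  simp_rw [hE] at key
  rw [← integral_laplaceVecPDF_rpow_mul hσ hσ', neg_neg] at key
  have hset : {ω | -u ≤ Real.log (laplaceVecPDF m σ fun l => m' l + σ' l * ε l ω) -
        Real.log (laplaceVecPDF m' σ' fun l => m' l + σ' l * ε l ω)} ⊆
      {ω | -(t * u) ≤ ∑ l, r l (m' l + σ' l * ε l ω)} := by
    intro ω hω
    simp only [Set.mem_ofPred_eq] at hω ⊢
    rw [log_laplaceVecPDF hσ, log_laplaceVecPDF hσ', ← Finset.sum_sub_distrib] at hω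
    rw [hr, ← Finset.mul_sum]
    nlinarith [mul_le_mul_of_nonneg_left hω ht.1.le]
  refine (measureReal_mono hset).trans (key.trans ?_)
  have h0 : 0 ≤ ∫ x, laplaceVecPDF m σ x ^ t * laplaceVecPDF m' σ' x ^ (1 - t) :=
    integral_nonneg fun x => mul_nonneg
      (Real.rpow_nonneg (Finset.prod_nonneg fun l _ => (laplacePDF_pos (hσ l) _).le) _)
      (Real.rpow_nonneg (Finset.prod_nonneg fun l _ => (laplacePDF_pos (hσ' l) _).le) _)
  refine mul_le_mul_of_nonneg_right (Real.exp_le_exp.2 ?_) h0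
  nlinarith [ht.2]

/-- Chernoff's bound for the error probability of the likelihood ratio test. -/
lemma measureReal_le_log_ratio_le_chernoff {Ω : Type*} [MeasurableSpace Ω] {d : ℕ}
    {P : Measure Ω} [IsProbabilityMeasure P] {ε : Fin d → Ω → ℝ} (hε : iIndepFun ε P)
    (hlaw : ∀ l, HasLaw (ε l) (laplaceMeasure 0 1) P) {m σ m' σ' : Fin d → ℝ}
    (hσ : ∀ l, 0 < σ l) (hσ' : ∀ l, 0 < σ' l) {u : ℝ} (hu : 0 ≤ u)
    (hpos : 0 < chernoff volume (laplaceVecPDF m σ) (laplaceVecPDF m' σ')) :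
    P.real {ω | -u ≤ Real.log (laplaceVecPDF m σ fun l => m' l + σ' l * ε l ω) -
        Real.log (laplaceVecPDF m' σ' fun l => m' l + σ' l * ε l ω)} ≤
      Real.exp (u - chernoff volume (laplaceVecPDF m σ) (laplaceVecPDF m' σ')) := by
  set I : ℝ := ⨅ t : Set.Ioo (0 : ℝ) 1,
    ∫ x, laplaceVecPDF m σ x ^ (t : ℝ) * laplaceVecPDF m' σ' x ^ (1 - (t : ℝ)) with hI
  have hI0 : 0 ≤ I := Real.iInf_nonneg fun t => integral_nonneg fun x => mul_nonneg
      (Real.rpow_nonneg (Finset.prod_nonneg fun l _ => (laplacePDF_pos (hσ l) _).le) _)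
      (Real.rpow_nonneg (Finset.prod_nonneg fun l _ => (laplacePDF_pos (hσ' l) _).le) _)
  -- The convention `Real.log 0 = 0` would make the Chernoff information vanish if the infimum were
  -- 0, so `hpos` excludes this case.
  have hIpos : 0 < I := by
    refine lt_of_le_of_ne hI0 fun h => ?_
    rw [chernoff, ← hI, ← h] at hpos
    simp at hpos
  have : Nonempty (Set.Ioo (0 : ℝ) 1) := ⟨⟨1 / 2, by norm_num⟩⟩
  rw [chernoff, ← hI, sub_neg_eq_add, Real.exp_add, Real.exp_log hIpos, mul_comm,
    ← div_le_iff₀ (Real.exp_pos u)]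
  refine le_ciInf fun t => ?_
  rw [div_le_iff₀ (Real.exp_pos u), mul_comm]
  exact measureReal_le_log_ratio_le hε hlaw hσ hσ' hu t.2

/-! ### The Chernoff information is at most of order d times the separation -/

lemma mul_laplacePDF_le {m m' σ σmin σmax D x : ℝ} (hσmin : 0 < σmin)
    (hσ : σmin ≤ σ ∧ σ ≤ σmax) (hD : |m - m'| ≤ D) :
    σmin / σmax * Real.exp (-(D / σmin)) * laplacePDF m σmin x ≤ laplacePDF m' σ x := by
  have h0 : 0 < σ := hσmin.trans_le hσ.1
  have h0' : 0 < σmax := h0.trans_le hσ.2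
  have h1 : |x - m'| ≤ |x - m| + D := by
    calc |x - m'| = |(x - m) + (m - m')| := by ring_nf
      _ ≤ |x - m| + |m - m'| := abs_add_le _ _
      _ ≤ _ := by gcongr
  unfold laplacePDF
  calc σmin / σmax * Real.exp (-(D / σmin)) * ((2 * σmin)⁻¹ * Real.exp (-(|x - m| / σmin)))
      = (2 * σmax)⁻¹ * Real.exp (-((|x - m| + D) / σmin)) := by
        have : Real.exp (-((|x - m| + D) / σmin)) =
            Real.exp (-(D / σmin)) * Real.exp (-(|x - m| / σmin)) := by
          rw [← Real.exp_add]; congr 1; ring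
        rw [this]; field_simp
    _ ≤ (2 * σ)⁻¹ * Real.exp (-(|x - m'| / σ)) := by
        have : |x - m'| / σ ≤ (|x - m| + D) / σmin :=
          div_le_div₀ ((abs_nonneg _).trans h1) h1 hσmin hσ.1
        gcongr
        exact hσ.2

/-- In each coordinate both densities dominate ρ times one common Laplace density, so every Chernoff
integral is at least ρ, whatever t is. The product over coordinates gives ρ ^ d. The bound serves to
show that a large Chernoff information forces a large separation. -/
lemma chernoff_le {d : ℕ} {m σ m' σ' : Fin d → ℝ} {σmin σmax D : ℝ} (hσmin : 0 < σmin)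
    (hmm : σmin ≤ σmax)
    (hσ : ∀ l, σmin ≤ σ l ∧ σ l ≤ σmax) (hσ' : ∀ l, σmin ≤ σ' l ∧ σ' l ≤ σmax)
    (hD0 : 0 ≤ D) (hD : ∀ l, |m l - m' l| ≤ D) :
    chernoff volume (laplaceVecPDF m σ) (laplaceVecPDF m' σ') ≤
      d * (Real.log (σmax / σmin) + D / σmin) := by
  have hσmax : 0 < σmax := hσmin.trans_le hmm
  set ρ : ℝ := σmin / σmax * Real.exp (-(D / σmin)) with hρ
  have hρ0 : 0 < ρ := by positivity
  have hp : ∀ l, 0 < σ l := fun l => hσmin.trans_le (hσ l).1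
  have hp' : ∀ l, 0 < σ' l := fun l => hσmin.trans_le (hσ' l).1
  have : Nonempty (Set.Ioo (0 : ℝ) 1) := ⟨⟨1 / 2, by norm_num⟩⟩
  have key : ρ ^ d ≤ ⨅ t : Set.Ioo (0 : ℝ) 1,
      ∫ x, laplaceVecPDF m σ x ^ (t : ℝ) * laplaceVecPDF m' σ' x ^ (1 - (t : ℝ)) := by
    refine le_ciInf fun t => ?_
    rw [integral_laplaceVecPDF_rpow_mul hp hp']
    calc ρ ^ d = ∏ _l : Fin d, ρ := by simp
      _ ≤ _ := by
        refine Finset.prod_le_prod (fun _ _ => hρ0.le) fun l _ => ?_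
        have h1 : ∫ x, ρ * laplacePDF (m l) σmin x = ρ := by
          rw [integral_const_mul, integral_laplacePDF hσmin, mul_one]
        rw [← h1]
        refine integral_mono ((integrable_laplacePDF hσmin).const_mul ρ)
          (integrable_laplacePDF_rpow_mul (hp l) (hp' l) t.2) fun x => ?_
        have hq : 0 < ρ * laplacePDF (m l) σmin x := mul_pos hρ0 (laplacePDF_pos hσmin x)
        calc ρ * laplacePDF (m l) σmin x
            = (ρ * laplacePDF (m l) σmin x) ^ (t : ℝ) *
              (ρ * laplacePDF (m l) σmin x) ^ (1 - (t : ℝ)) := by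
              rw [← Real.rpow_add hq]; simp
          _ ≤ _ := by
            have ht1 := t.2.1.le
            have ht2 : 0 ≤ 1 - (t : ℝ) := by linarith [t.2.2]
            have := (laplacePDF_pos (m := m l) (hp l) x).le
            gcongr
            · exact mul_laplacePDF_le hσmin (hσ l) (by simpa using hD0)
            · exact mul_laplacePDF_le hσmin (hσ' l) (hD l)
  have hlog := Real.log_le_log (by positivity) key
  rw [Real.log_pow, hρ, Real.log_mul (by positivity) (Real.exp_ne_zero _), Real.log_exp,
    Real.log_div hσmin.ne' hσmax.ne'] at hlog
  rw [chernoff, Real.log_div hσmax.ne' hσmin.ne']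
  linarith

lemma chernoffFamily_le {k d : ℕ} {μ σ : Fin k → Fin d → ℝ} {a b : Fin k} (hab : a ≠ b) :
    chernoffFamily μ σ ≤
      chernoff volume (laplaceVecPDF (μ a) (σ a)) (laplaceVecPDF (μ b) (σ b)) :=
  ciInf_le (f := fun p : {p : Fin k × Fin k // p.1 ≠ p.2} =>
    chernoff volume (laplaceVecPDF (μ p.1.1) (σ p.1.1)) (laplaceVecPDF (μ p.1.2) (σ p.1.2)))
    (Set.finite_range _).bddBelow ⟨(a, b), hab⟩

lemma maxSep_nonneg {k d : ℕ} (μ : Fin k → Fin d → ℝ) : 0 ≤ maxSep μ :=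
  Real.iSup_nonneg fun _ => norm_nonneg _

lemma abs_sub_le_maxSep {k d : ℕ} (μ : Fin k → Fin d → ℝ) (a b : Fin k) (l : Fin d) :
    |μ a l - μ b l| ≤ maxSep μ := by
  by_cases hab : a = b
  · simpa [hab] using maxSep_nonneg μ
  · exact (norm_le_pi_norm (μ a - μ b) l).trans
      (le_ciSup (f := fun p : {p : Fin k × Fin k // p.1 ≠ p.2} => ‖μ p.1.1 - μ p.1.2‖)
        (Set.finite_range _).bddAbove ⟨(a, b), hab⟩)

lemma chernoffFamily_le_maxSep {k d : ℕ} {μ σ : Fin k → Fin d → ℝ} (hk : 2 ≤ k)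
    {σmin σmax : ℝ} (hσmin : 0 < σmin) (hmm : σmin ≤ σmax)
    (hσ : ∀ a l, σmin ≤ σ a l ∧ σ a l ≤ σmax) :
    chernoffFamily μ σ ≤ d * (Real.log (σmax / σmin) + maxSep μ / σmin) := by
  have hab : (⟨0, by omega⟩ : Fin k) ≠ ⟨1, by omega⟩ := by simp
  exact (chernoffFamily_le hab).trans (chernoff_le hσmin hmm (hσ _) (hσ _) (maxSep_nonneg μ)
    (abs_sub_le_maxSep μ _ _))

/-! ### Stability of the estimates under few labelling errors -/

lemma abs_cluster_sum_sub_le {n k : ℕ} (z w : Fin n → Fin k) (a : Fin k) (g : Fin n → ℝ) :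
    |∑ i with w i = a, g i - ∑ i with z i = a, g i| ≤ ∑ i with z i ≠ w i, |g i| := by
  rw [Finset.sum_filter, Finset.sum_filter, Finset.sum_filter, ← Finset.sum_sub_distrib]
  refine (Finset.abs_sum_le_sum_abs _ _).trans (Finset.sum_le_sum fun i _ => ?_)
  by_cases h : z i = w i
  · simp [h]
  · rw [if_pos h]
    by_cases h1 : w i = a
    · have h2 : z i ≠ a := fun h2 => h (h2.trans h1.symm)
      simp [h1, h2]
    · by_cases h2 : z i = a <;> simp [h1, h2]

lemma clusterSize_eq_sum {n k : ℕ} (z : Fin n → Fin k) (a : Fin k) :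
    (clusterSize z a : ℝ) = ∑ i with z i = a, (1 : ℝ) := by
  simp [clusterSize]

lemma hammingDist_eq_sum {n k : ℕ} (z w : Fin n → Fin k) :
    (hammingDist z w : ℝ) = ∑ i with z i ≠ w i, (1 : ℝ) := by
  simp [hammingDist]

/-- The cluster averages of a function with small averages over the true clusters are small for
every labelling that is close to the true one. -/
lemma abs_cluster_avg_le {n k : ℕ} {z w : Fin n → Fin k} {a : Fin k} {g e : Fin n → ℝ}
    {A B δ s N : ℝ} (hN : 0 < N) (hNa : N ≤ clusterSize z a) (hδ0 : 0 ≤ δ) (hδ : δ ≤ 1 / 2)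
    (hB : 0 ≤ B) (hz : |∑ i with z i = a, g i| ≤ B * (δ * clusterSize z a))
    (hg : ∀ i, |g i| ≤ A + B * |e i|) (he : ∑ i, max (|e i| - s) 0 ≤ δ * N)
    (h1 : hammingDist z w ≤ δ * N) (hh : hammingDist z w * (A + B * s) ≤ (1 + B) * (δ * N)) :
    0 < (clusterSize w a : ℝ) ∧
      |(clusterSize w a : ℝ)⁻¹ * ∑ i with w i = a, g i| ≤ 2 * (1 + 3 * B) * δ := by
  -- The constant function 1 turns the comparison of sums into one of cluster sizes; δ ≤ 1/2 keeps
  -- at least half of each true cluster. The final factor 2 comes from here.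
  have hsize : (clusterSize z a : ℝ) / 2 ≤ clusterSize w a := by
    have := abs_cluster_sum_sub_le z w a fun _ => 1
    simp only [abs_one] at this
    rw [← clusterSize_eq_sum, ← clusterSize_eq_sum, ← hammingDist_eq_sum] at this
    nlinarith [neg_le_of_abs_le this]
  have hpos : 0 < (clusterSize w a : ℝ) := by linarith
  refine ⟨hpos, ?_⟩
  -- Each mislabelled point pays A + Bs for the noise below the cut; whatever exceeds s is charged
  -- to the sum over all points, regardless of which ones are mislabelled.
  have h2 : ∑ i with z i ≠ w i, |g i| ≤ (1 + 2 * B) * (δ * N) := by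
    calc ∑ i with z i ≠ w i, |g i|
        ≤ ∑ i with z i ≠ w i, (1 * (A + B * s) + B * max (|e i| - s) 0) := by
          refine Finset.sum_le_sum fun i _ => (hg i).trans ?_
          nlinarith [mul_le_mul_of_nonneg_left (le_max_left (|e i| - s) 0) hB]
      _ = hammingDist z w * (A + B * s) + B * ∑ i with z i ≠ w i, max (|e i| - s) 0 := by
          rw [Finset.sum_add_distrib, ← Finset.sum_mul, ← hammingDist_eq_sum, Finset.mul_sum]
      _ ≤ (1 + B) * (δ * N) + B * (δ * N) := by
          gcongr
          exact (Finset.sum_le_univ_sum_of_nonneg fun i => le_max_right _ _).trans he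
      _ = _ := by ring
  have h3 := abs_cluster_sum_sub_le z w a g
  have h4 : |∑ i with w i = a, g i| ≤ (1 + 3 * B) * (δ * clusterSize z a) := by
    have h5 := abs_sub_abs_le_abs_sub (∑ i with w i = a, g i) (∑ i with z i = a, g i)
    have h6 : (1 + 2 * B) * (δ * N) ≤ (1 + 2 * B) * (δ * clusterSize z a) := by gcongr
    linarith
  rw [abs_mul, abs_of_pos (inv_pos.2 hpos), inv_mul_le_iff₀ hpos]
  refine h4.trans ?_
  have : 0 ≤ (1 + 3 * B) * δ := by positivity
  nlinarith

/-- The noise behaves regularly: its averages, and those of its absolute values, over the true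
clusters are close to their expectations, and it has few large entries. -/
structure GoodNoise {n k d : ℕ} (z : Fin n → Fin k) (e : Fin n → Fin d → ℝ) (δ s N : ℝ) : Prop where
  avg : ∀ a l, |∑ i with z i = a, e i l| ≤ δ * clusterSize z a
  avg_abs : ∀ a l, |∑ i with z i = a, (|e i l| - 1)| ≤ δ * clusterSize z a
  excess : ∀ l, ∑ i, max (|e i l| - s) 0 ≤ δ * N

/-- The noise event does not involve `w`, so the bound holds simultaneously for all labellings with
few errors, including data-dependent ones. Errors are weighted by s + D + 1, since a mislabelled
point shifts a cluster sum by order D plus its truncated noise. -/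
lemma GoodNoise.abs_est_sub_le {n k d : ℕ} {z w : Fin n → Fin k} {e x : Fin n → Fin d → ℝ}
    {μ σ : Fin k → Fin d → ℝ} {δ s N D σmax : ℝ} (he : GoodNoise z e δ s N)
    (hx : ∀ i l, x i l = μ (z i) l + σ (z i) l * e i l) (hσ0 : ∀ a l, 0 < σ a l)
    (hσ : ∀ a l, σ a l ≤ σmax) (hD0 : 0 ≤ D) (hD : ∀ a b l, |μ a l - μ b l| ≤ D)
    (hN : 0 < N) (hNa : ∀ a, N ≤ clusterSize z a) (hδ0 : 0 ≤ δ) (hδ : δ ≤ 1 / 2) (hs : 0 ≤ s)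
    (hw : hammingDist z w * (s + D + 1) ≤ δ * N) (a : Fin k) (l : Fin d) :
    |estLoc x w a l - μ a l| ≤ 4 * (1 + 3 * σmax) * δ ∧
      |estScale x w a l - σ a l| ≤ 4 * (1 + 3 * σmax) * δ := by
  have hσm : 0 ≤ σmax := (hσ0 a l).le.trans (hσ a l)
  have hH : (0 : ℝ) ≤ hammingDist z w := Nat.cast_nonneg _
  have h1 : hammingDist z w ≤ δ * N := by
    refine le_trans ?_ hw
    nlinarith [mul_nonneg hH (add_nonneg hs hD0)]
  have hh : hammingDist z w * ((D + σmax) + σmax * s) ≤ (1 + σmax) * (δ * N) := by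
    calc hammingDist z w * ((D + σmax) + σmax * s)
        ≤ hammingDist z w * ((1 + σmax) * (s + D + 1)) := by
          gcongr; nlinarith [mul_nonneg hσm hD0]
      _ = (1 + σmax) * (hammingDist z w * (s + D + 1)) := by ring
      _ ≤ _ := by gcongr
  have habs : ∀ i, |x i l - μ a l| ≤ D + σmax * |e i l| := fun i => by
    rw [hx]
    calc |μ (z i) l + σ (z i) l * e i l - μ a l|
        = |(μ (z i) l - μ a l) + σ (z i) l * e i l| := by ring_nf
      _ ≤ |μ (z i) l - μ a l| + |σ (z i) l * e i l| := abs_add_le _ _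
      _ ≤ _ := by
        rw [abs_mul, abs_of_pos (hσ0 _ _)]
        gcongr
        exacts [hD _ _ _, hσ _ _]
  have hz1 : |∑ i with z i = a, (x i l - μ a l)| ≤ σmax * (δ * clusterSize z a) := by
    have : ∑ i with z i = a, (x i l - μ a l) = σ a l * ∑ i with z i = a, e i l := by
      rw [Finset.mul_sum]
      refine Finset.sum_congr rfl fun i hi => ?_
      rw [hx, (Finset.mem_filter.1 hi).2]; ring
    rw [this, abs_mul, abs_of_pos (hσ0 a l)]
    exact mul_le_mul (hσ a l) (he.avg a l) (abs_nonneg _) hσm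
  have hz2 : |∑ i with z i = a, (|x i l - μ a l| - σ a l)| ≤ σmax * (δ * clusterSize z a) := by
    have : ∑ i with z i = a, (|x i l - μ a l| - σ a l) =
        σ a l * ∑ i with z i = a, (|e i l| - 1) := by
      rw [Finset.mul_sum]
      refine Finset.sum_congr rfl fun i hi => ?_
      rw [hx, (Finset.mem_filter.1 hi).2, add_sub_cancel_left, abs_mul, abs_of_pos (hσ0 a l)]
      ring
    rw [this, abs_mul, abs_of_pos (hσ0 a l)]
    exact mul_le_mul (hσ a l) (he.avg_abs a l) (abs_nonneg _) hσm
  obtain ⟨hpos, hloc⟩ := abs_cluster_avg_le (w := w) (g := fun i => x i l - μ a l)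
    (e := fun i => e i l) (A := D + σmax) hN (hNa a) hδ0 hδ hσm hz1
    (fun i => (habs i).trans (by linarith)) (he.excess l) h1 hh
  obtain ⟨-, hscale⟩ := abs_cluster_avg_le (w := w) (g := fun i => |x i l - μ a l| - σ a l)
    (e := fun i => e i l) (A := D + σmax) hN (hNa a) hδ0 hδ hσm hz2
    (fun i => by
      have h2 := habs i
      have h3 := abs_nonneg (x i l - μ a l)
      have h4 := hσ a l
      have h5 := hσ0 a l
      have h6 := mul_nonneg hσm (abs_nonneg (e i l))
      rw [abs_le]; constructor <;> linarith) (he.excess l) h1 hh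
  set M : ℝ := (clusterSize w a : ℝ) with hM
  have havg : ∀ c : ℝ, M⁻¹ * ∑ i with w i = a, c = c := fun c => by
    have : ∑ i with w i = a, c = M * c := by
      rw [hM, clusterSize_eq_sum, Finset.sum_mul]; simp
    rw [this, inv_mul_cancel_left₀ hpos.ne']
  have hloc' : estLoc x w a l - μ a l = M⁻¹ * ∑ i with w i = a, (x i l - μ a l) := by
    rw [Finset.sum_sub_distrib, mul_sub, havg]; rfl
  rw [← hloc'] at hloc
  -- Deviations are first taken from the true location. Recentring at the sample mean costs at most
  -- the location error, which doubles the constant from 2 to 4.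
  have hscale' : estScale x w a l - σ a l =
      M⁻¹ * ∑ i with w i = a, (|x i l - μ a l| - σ a l) +
        M⁻¹ * ∑ i with w i = a, (|x i l - estLoc x w a l| - |x i l - μ a l|) := by
    rw [← mul_add, ← Finset.sum_add_distrib]
    have : ∀ i, |x i l - μ a l| - σ a l + (|x i l - estLoc x w a l| - |x i l - μ a l|) =
      |x i l - estLoc x w a l| - σ a l := fun i => by ring
    simp_rw [this]
    rw [Finset.sum_sub_distrib, mul_sub, havg]; rfl
  have hlast : |M⁻¹ * ∑ i with w i = a, (|x i l - estLoc x w a l| - |x i l - μ a l|)| ≤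
      |estLoc x w a l - μ a l| := by
    rw [abs_mul, abs_of_pos (inv_pos.2 hpos)]
    refine le_trans ?_ (havg |estLoc x w a l - μ a l|).le
    refine mul_le_mul_of_nonneg_left ((Finset.abs_sum_le_sum_abs _ _).trans
      (Finset.sum_le_sum fun i _ => (abs_abs_sub_abs_le _ _).trans ?_)) (inv_pos.2 hpos).le
    rw [sub_sub_sub_cancel_left, abs_sub_comm]
  constructor
  · nlinarith [abs_nonneg (estLoc x w a l - μ a l)]
  · rw [hscale']
    exact (abs_add_le _ _).trans (by linarith)

/-! ### Perturbed log-likelihoods and bad points -/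

lemma abs_log_sub_log_le {x y c : ℝ} (hc : 0 < c) (hx : c ≤ x) (hy : c ≤ y) :
    |Real.log x - Real.log y| ≤ |x - y| / c := by
  wlog h : y ≤ x generalizing x y
  · rw [abs_sub_comm, abs_sub_comm x]; exact this hy hx (le_of_not_ge h)
  have hy0 : 0 < y := hc.trans_le hy
  rw [abs_of_nonneg (sub_nonneg.2 (Real.log_le_log hy0 h)), abs_of_nonneg (sub_nonneg.2 h),
    ← Real.log_div (hy0.trans_le h).ne' hy0.ne']
  refine (Real.log_le_sub_one_of_pos (div_pos (hy0.trans_le h) hy0)).trans ?_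
  rw [div_sub_one hy0.ne']
  exact div_le_div_of_nonneg_left (sub_nonneg.2 h) hc hy

/-- The error splits into the change of the normalising constant, of the location and of the scale.
Only the last grows with x, and linearly, so after summation over coordinates it is governed by ∑
|ε|. The condition r ≤ σmin / 2 keeps the perturbed scale above σmin / 2. -/
lemma abs_log_laplacePDF_sub_le {m σ m' σ' σmin r : ℝ} (hσmin : 0 < σmin) (hσ : σmin ≤ σ)
    (hr : r ≤ σmin / 2) (hm : |m' - m| ≤ r) (hs : |σ' - σ| ≤ r) (x : ℝ) :
    |Real.log (laplacePDF m' σ' x) - Real.log (laplacePDF m σ x)| ≤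
      r * (4 / σmin + 2 / σmin ^ 2 * |x - m|) := by
  have h0 : 0 < σ := hσmin.trans_le hσ
  have h1 : σmin / 2 ≤ σ' := by linarith [neg_le_of_abs_le hs]
  have h0' : 0 < σ' := by linarith
  have hr0 : 0 ≤ r := (abs_nonneg _).trans hm
  rw [log_laplacePDF h0, log_laplacePDF h0', Real.log_mul two_ne_zero h0.ne',
    Real.log_mul two_ne_zero h0'.ne']
  have e1 : |Real.log σ - Real.log σ'| ≤ r / (σmin / 2) := by
    refine (abs_log_sub_log_le (c := σmin / 2) (by positivity) (by linarith) h1).trans ?_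
    rw [abs_sub_comm]; gcongr
  have e2 : |(|x - m| - |x - m'|) / σ'| ≤ r / (σmin / 2) := by
    rw [abs_div, abs_of_pos h0']
    refine div_le_div₀ hr0 ((abs_abs_sub_abs_le _ _).trans ?_) (by positivity) h1
    rwa [sub_sub_sub_cancel_left]
  have e3 : |(|x - m| * ((σ' - σ) / (σ * σ')))| ≤ |x - m| * (r / (σmin * (σmin / 2))) := by
    rw [abs_mul, abs_abs, abs_div, abs_of_pos (mul_pos h0 h0')]
    refine mul_le_mul_of_nonneg_left ?_ (abs_nonneg _)
    exact div_le_div₀ hr0 hs (by positivity) (mul_le_mul hσ h1 (by positivity) h0.le)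
  have key : -(Real.log 2 + Real.log σ') - |x - m'| / σ' -
      (-(Real.log 2 + Real.log σ) - |x - m| / σ) =
      (Real.log σ - Real.log σ') + (|x - m| - |x - m'|) / σ' +
        |x - m| * ((σ' - σ) / (σ * σ')) := by
    field_simp; ring
  rw [key]
  calc _ ≤ r / (σmin / 2) + r / (σmin / 2) + |x - m| * (r / (σmin * (σmin / 2))) :=
        (abs_add_le _ _).trans (add_le_add ((abs_add_le _ _).trans (add_le_add e1 e2)) e3)
    _ = _ := by field_simp; ring

/-- A point with noise `e` and true label `a` that may be misclassified: the noise is large, or the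
likelihood ratio test against some other cluster, with margin `u`, fails. -/
def BadPoint {k d : ℕ} (μ σ : Fin k → Fin d → ℝ) (T u : ℝ) (a : Fin k) (e : Fin d → ℝ) : Prop :=
  T ≤ ∑ l, |e l| ∨ ∃ b, b ≠ a ∧
    -u ≤ Real.log (laplaceVecPDF (μ b) (σ b) fun l => μ a l + σ a l * e l) -
      Real.log (laplaceVecPDF (μ a) (σ a) fun l => μ a l + σ a l * e l)

/-- If the noise of the point is not large, estimation moves each log-likelihood by at most u/2. A
wrong choice under the estimates then means that the true likelihood ratio test fails up to the
margin u. -/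
lemma badPoint_of_isStep {n k d : ℕ} {z w w' : Fin n → Fin k} {e x : Fin n → Fin d → ℝ}
    {μ σ : Fin k → Fin d → ℝ} {D σmin σmax r T u : ℝ}
    (hx : ∀ i l, x i l = μ (z i) l + σ (z i) l * e i l) (hσmin : 0 < σmin)
    (hσ : ∀ a l, σmin ≤ σ a l ∧ σ a l ≤ σmax) (hσmax : 0 ≤ σmax)
    (hD : ∀ a b l, |μ a l - μ b l| ≤ D)
    (hr0 : 0 ≤ r) (hr : r ≤ σmin / 2) (hloc : ∀ a l, |estLoc x w a l - μ a l| ≤ r)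
    (hscale : ∀ a l, |estScale x w a l - σ a l| ≤ r)
    (hu : 2 * r * (4 / σmin * d + 2 / σmin ^ 2 * (d * D + σmax * T)) ≤ u)
    (hstep : IsStep x w w') {i : Fin n} (hi : z i ≠ w' i) : BadPoint μ σ T u (z i) (e i) := by
  have hpos : ∀ a l, 0 < estScale x w a l := fun a l => by
    linarith [neg_le_of_abs_le (hscale a l), (hσ a l).1]
  have hσ0 : ∀ a l, 0 < σ a l := fun a l => hσmin.trans_le (hσ a l).1
  rw [BadPoint, or_iff_not_imp_left]
  intro hT
  have hT' : ∑ l, |e i l| ≤ T := (not_le.1 hT).le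
  refine ⟨w' i, hi.symm, ?_⟩
  have hxi : (fun l => μ (z i) l + σ (z i) l * e i l) = x i := funext fun l => (hx i l).symm
  rw [hxi]
  have hclose : ∀ a, |Real.log (laplaceVecPDF (estLoc x w a) (estScale x w a) (x i)) -
      Real.log (laplaceVecPDF (μ a) (σ a) (x i))| ≤ u / 2 := fun a => by
    rw [log_laplaceVecPDF (hpos a), log_laplaceVecPDF (hσ0 a), ← Finset.sum_sub_distrib]
    calc _ ≤ ∑ l, r * (4 / σmin + 2 / σmin ^ 2 * (D + σmax * |e i l|)) := by
          refine (Finset.abs_sum_le_sum_abs _ _).trans (Finset.sum_le_sum fun l _ => ?_)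
          refine (abs_log_laplacePDF_sub_le hσmin (hσ a l).1 hr (hloc a l) (hscale a l) _).trans ?_
          gcongr
          rw [hx]
          calc |μ (z i) l + σ (z i) l * e i l - μ a l|
              = |(μ (z i) l - μ a l) + σ (z i) l * e i l| := by ring_nf
            _ ≤ |μ (z i) l - μ a l| + |σ (z i) l * e i l| := abs_add_le _ _
            _ ≤ _ := by
              rw [abs_mul, abs_of_pos (hσ0 _ _)]
              gcongr
              exacts [hD _ _ _, (hσ _ _).2]
      _ = r * (4 / σmin * d + 2 / σmin ^ 2 * (d * D + σmax * ∑ l, |e i l|)) := by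
          simp only [← Finset.mul_sum, Finset.sum_add_distrib, Finset.sum_const, Finset.card_univ,
            Fintype.card_fin, nsmul_eq_mul]
          ring
      _ ≤ r * (4 / σmin * d + 2 / σmin ^ 2 * (d * D + σmax * T)) := by gcongr
      _ ≤ _ := by linarith
  have h1 := hstep hpos i (z i)
  have h2 := abs_le.1 (hclose (z i))
  have h3 := abs_le.1 (hclose (w' i))
  linarith [h2.1, h3.2]

/-! ### Probabilities of irregular noise and of bad points -/

lemma measureReal_mul_card_le_sum_le {Ω : Type*} [MeasurableSpace Ω] {n : ℕ} {P : Measure Ω}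
    [IsProbabilityMeasure P] {ε : Fin n → Ω → ℝ} (hε : iIndepFun ε P)
    (hlaw : ∀ i, HasLaw (ε i) (laplaceMeasure 0 1) P) {Y : ℝ → ℝ} (hY : Measurable Y)
    (hYb : ∀ x, |Y x| ≤ |x| + 1) (hY0 : ∫ x, Y x ∂laplaceMeasure 0 1 = 0) (S : Finset (Fin n))
    {δ : ℝ} (hδ0 : 0 ≤ δ) (hδ : δ ≤ 1) :
    P.real {ω | δ * S.card ≤ ∑ i ∈ S, Y (ε i ω)} ≤ Real.exp (-(δ ^ 2 / 512 * S.card)) := by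
  -- The exponent r δ - 128 r² is maximal at r = δ / 256, with value δ² / 512.
  have hr : δ / 256 ≤ 1 / 4 := by linarith
  have hm := mgf_laplaceMeasure_le hY hYb hY0 (by positivity : 0 ≤ δ / 256) hr
  have key := measureReal_le_sum_comp_le hε hlaw (g := fun _ x => δ / 256 * Y x)
    (fun _ => by fun_prop) S (fun _ _ => hm.1) (δ / 256 * (δ * S.card))
  rw [Finset.prod_const] at key
  have hset : {ω | δ * S.card ≤ ∑ i ∈ S, Y (ε i ω)} ⊆
      {ω | δ / 256 * (δ * S.card) ≤ ∑ i ∈ S, δ / 256 * Y (ε i ω)} := fun ω hω => by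
    simp only [Set.mem_ofPred_eq] at hω ⊢
    rw [← Finset.mul_sum]
    exact mul_le_mul_of_nonneg_left hω (by positivity)
  refine (measureReal_mono hset).trans (key.trans ?_)
  have h0 : 0 ≤ ∫ x, Real.exp (δ / 256 * Y x) ∂laplaceMeasure 0 1 :=
    integral_nonneg fun x => (Real.exp_pos _).le
  calc _ ≤ Real.exp (-(δ / 256 * (δ * S.card))) * Real.exp (128 * (δ / 256) ^ 2) ^ S.card := by
        gcongr; exact hm.2
    _ = _ := by
      rw [← Real.exp_nat_mul, ← Real.exp_add]; congr 1; ring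

lemma measureReal_lt_abs_sum_le {Ω : Type*} [MeasurableSpace Ω] {n : ℕ} {P : Measure Ω}
    [IsProbabilityMeasure P] {ε : Fin n → Ω → ℝ} (hε : iIndepFun ε P)
    (hlaw : ∀ i, HasLaw (ε i) (laplaceMeasure 0 1) P) {Y : ℝ → ℝ} (hY : Measurable Y)
    (hYb : ∀ x, |Y x| ≤ |x| + 1) (hY0 : ∫ x, Y x ∂laplaceMeasure 0 1 = 0) (S : Finset (Fin n))
    {δ : ℝ} (hδ0 : 0 ≤ δ) (hδ : δ ≤ 1) :
    P.real {ω | δ * S.card < |∑ i ∈ S, Y (ε i ω)|} ≤ 2 * Real.exp (-(δ ^ 2 / 512 * S.card)) := by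
  have h1 := measureReal_mul_card_le_sum_le hε hlaw hY hYb hY0 S hδ0 hδ
  have h2 := measureReal_mul_card_le_sum_le hε hlaw (Y := fun x => -Y x) hY.neg
    (fun x => by simpa using hYb x) (by rw [integral_neg, hY0, neg_zero]) S hδ0 hδ
  have hset : {ω | δ * S.card < |∑ i ∈ S, Y (ε i ω)|} ⊆
      {ω | δ * S.card ≤ ∑ i ∈ S, Y (ε i ω)} ∪ {ω | δ * S.card ≤ ∑ i ∈ S, -Y (ε i ω)} := by
    intro ω hω
    simp only [Set.mem_ofPred_eq, Set.mem_union, Finset.sum_neg_distrib] at hω ⊢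
    rcases lt_abs.1 hω with h | h
    exacts [Or.inl h.le, Or.inr h.le]
  linarith [(measureReal_mono hset (μ := P)).trans (measureReal_union_le _ _)]

/-- Truncation at s leaves an exponential moment of at most 1 + 2 exp(-s/2) per point, so the total
excess is small over all n points at once, as needed for arbitrary sets of errors. -/
lemma measureReal_lt_sum_excess_le {Ω : Type*} [MeasurableSpace Ω] {n : ℕ} {P : Measure Ω}
    [IsProbabilityMeasure P] {ε : Fin n → Ω → ℝ} (hε : iIndepFun ε P)
    (hlaw : ∀ i, HasLaw (ε i) (laplaceMeasure 0 1) P) (s v : ℝ) :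
    P.real {ω | v < ∑ i, max (|ε i ω| - s) 0} ≤
      Real.exp (2 * n * Real.exp (-(s / 2)) - v / 2) := by
  have hpt : ∀ x : ℝ, Real.exp (max (|x| - s) 0 / 2) ≤
      1 + Real.exp (-(s / 2)) * Real.exp (|x| / 2) := fun x => by
    rw [← Real.exp_add]
    rcases le_total (|x| - s) 0 with h | h
    · rw [max_eq_right h]; simp [Real.exp_nonneg]
    · rw [max_eq_left h, show (|x| - s) / 2 = -(s / 2) + |x| / 2 by ring]; linarith
  have hbi : Integrable (fun x => 1 + Real.exp (-(s / 2)) * Real.exp (|x| / 2))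
      (laplaceMeasure 0 1) := (integrable_const _).add (integrable_exp_half_abs.const_mul _)
  have hI : Integrable (fun x => Real.exp (max (|x| - s) 0 / 2)) (laplaceMeasure 0 1) :=
    hbi.mono (by fun_prop) (ae_of_all _ fun x => by
      rw [Real.norm_eq_abs, Real.norm_eq_abs, abs_of_pos (Real.exp_pos _)]
      exact (hpt x).trans (le_abs_self _))
  have hE : ∫ x, Real.exp (max (|x| - s) 0 / 2) ∂laplaceMeasure 0 1 ≤
      Real.exp (2 * Real.exp (-(s / 2))) := by
    refine (integral_mono hI hbi hpt).trans ?_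
    rw [integral_add (integrable_const _) (integrable_exp_half_abs.const_mul _),
      integral_const_mul, integral_exp_half_abs]
    have := Real.add_one_le_exp (2 * Real.exp (-(s / 2)))
    simp only [integral_const, probReal_univ, smul_eq_mul]
    linarith
  have key := measureReal_le_sum_comp_le hε hlaw (g := fun _ x => max (|x| - s) 0 / 2)
    (fun _ => by fun_prop) Finset.univ (fun _ _ => hI) (v / 2)
  rw [Finset.prod_const, Finset.card_univ, Fintype.card_fin] at key
  have hset : {ω | v < ∑ i, max (|ε i ω| - s) 0} ⊆
      {ω | v / 2 ≤ ∑ i, max (|ε i ω| - s) 0 / 2} := fun ω hω => by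
    simp only [Set.mem_ofPred_eq] at hω ⊢
    rw [← Finset.sum_div]; linarith
  refine (measureReal_mono hset).trans (key.trans ?_)
  have h0 : 0 ≤ ∫ x, Real.exp (max (|x| - s) 0 / 2) ∂laplaceMeasure 0 1 :=
    integral_nonneg fun x => (Real.exp_pos _).le
  calc _ ≤ Real.exp (-(v / 2)) * Real.exp (2 * Real.exp (-(s / 2))) ^ n := by gcongr
    _ = _ := by
      rw [← Real.exp_nat_mul, ← Real.exp_add]; congr 1; ring

lemma measureReal_le_sum_abs_le {Ω : Type*} [MeasurableSpace Ω] {d : ℕ} {P : Measure Ω}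
    [IsProbabilityMeasure P] {ε : Fin d → Ω → ℝ} (hε : iIndepFun ε P)
    (hlaw : ∀ l, HasLaw (ε l) (laplaceMeasure 0 1) P) (T : ℝ) :
    P.real {ω | T ≤ ∑ l, |ε l ω|} ≤ Real.exp (d - T / 2) := by
  have key := measureReal_le_sum_comp_le hε hlaw (g := fun _ x => |x| / 2)
    (fun _ => by fun_prop) Finset.univ (fun _ _ => integrable_exp_half_abs) (T / 2)
  rw [Finset.prod_const, Finset.card_univ, Fintype.card_fin, integral_exp_half_abs] at key
  have hset : {ω | T ≤ ∑ l, |ε l ω|} ⊆ {ω | T / 2 ≤ ∑ l, |ε l ω| / 2} := fun ω hω => by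
    simp only [Set.mem_ofPred_eq] at hω ⊢
    rw [← Finset.sum_div]; linarith
  refine (measureReal_mono hset).trans (key.trans ?_)
  have h2 : (2 : ℝ) ≤ Real.exp 1 := by linarith [Real.add_one_le_exp 1]
  calc _ ≤ Real.exp (-(T / 2)) * Real.exp 1 ^ d := by gcongr
    _ = _ := by rw [← Real.exp_nat_mul, ← Real.exp_add]; congr 1; ring

/-- The number of events that occur is controlled by the sum of their probabilities. -/
lemma measureReal_lt_card_mul_le {Ω : Type*} [MeasurableSpace Ω] {n : ℕ} {P : Measure Ω}
    [IsProbabilityMeasure P] (A : Fin n → Set Ω) {p M : ℝ} (hM : 0 ≤ M)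
    (hA : ∀ i, P.real (A i) ≤ p) :
    P.real {ω | M < ∑ i, (A i).indicator 1 ω} * M ≤ n * p := by
  -- The events are not assumed measurable; measurable hulls have the same probabilities and only
  -- increase the count.
  set B : Fin n → Set Ω := fun i => toMeasurable P (A i) with hB
  have hBm : ∀ i, MeasurableSet (B i) := fun i => measurableSet_toMeasurable _ _
  have hint : ∀ i, Integrable ((B i).indicator (1 : Ω → ℝ)) P := fun i =>
    (integrable_const (1 : ℝ)).indicator (hBm i)
  have h1 := mul_meas_ge_le_integral_of_nonneg (μ := P)
    (f := fun ω => ∑ i, (B i).indicator (1 : Ω → ℝ) ω)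
    (ae_of_all _ fun ω => Finset.sum_nonneg fun i _ => Set.indicator_nonneg (by simp) _)
    (integrable_finsetSum _ fun i _ => hint i) M
  rw [integral_finsetSum _ fun i _ => hint i] at h1
  have h2 : ∀ i, ∫ ω, (B i).indicator (1 : Ω → ℝ) ω ∂P = P.real (A i) := fun i => by
    rw [integral_indicator_one (hBm i), measureReal_def, measureReal_def, hB,
      measure_toMeasurable]
  simp_rw [h2] at h1
  have h3 : ∑ i, P.real (A i) ≤ n * p := by
    calc _ ≤ ∑ _i : Fin n, p := Finset.sum_le_sum fun i _ => hA i
      _ = _ := by simp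
  refine le_trans ?_ (h1.trans h3)
  rw [mul_comm]
  refine mul_le_mul_of_nonneg_left (measureReal_mono fun ω hω => ?_) hM
  have hω' : M < ∑ i, (A i).indicator (1 : Ω → ℝ) ω := hω
  refine hω'.le.trans (Finset.sum_le_sum fun i _ => ?_)
  exact Set.indicator_le_indicator_of_subset (subset_toMeasurable P (A i)) (by simp) ω

lemma measureReal_iUnion_fin_le {Ω : Type*} [MeasurableSpace Ω] {P : Measure Ω} {m : ℕ}
    (A : Fin m → Set Ω) {p : ℝ}
    (hA : ∀ i, P.real (A i) ≤ p) : P.real (⋃ i, A i) ≤ m * p :=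
  (measureReal_iUnion_fintype_le _).trans ((Finset.sum_le_sum fun i _ => hA i).trans (by simp))

section Noise

variable {Ω : Type*} [MeasurableSpace Ω] {n k d : ℕ} {P : Measure Ω} [IsProbabilityMeasure P]
  {ε : Fin n × Fin d → Ω → ℝ}

lemma measureReal_not_goodNoise_le (hε : iIndepFun ε P)
    (hlaw : ∀ p, HasLaw (ε p) (laplaceMeasure 0 1) P) (z : Fin n → Fin k) (hk : 1 ≤ k)
    {δ s N : ℝ} (hδ0 : 0 ≤ δ) (hδ : δ ≤ 1) (hN : 0 ≤ N) (hNa : ∀ a, N ≤ clusterSize z a)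
    (hs : 2 * n * Real.exp (-(s / 2)) ≤ δ * N / 4) :
    P.real {ω | ¬ GoodNoise z (fun i l => ε (i, l) ω) δ s N} ≤
      5 * ((d * k) * Real.exp (-(δ ^ 2 / 512 * N))) := by
  set q : ℝ := Real.exp (-(δ ^ 2 / 512 * N)) with hq
  have hind : ∀ l, iIndepFun (fun i => ε (i, l)) P := fun l =>
    hε.precomp (g := fun i => (i, l)) fun i j h => (Prod.ext_iff.1 h).1
  have havg : ∀ Y : ℝ → ℝ, Measurable Y → (∀ x, |Y x| ≤ |x| + 1) →
      ∫ x, Y x ∂laplaceMeasure 0 1 = 0 → ∀ a l,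
      P.real {ω | δ * clusterSize z a < |∑ i with z i = a, Y (ε (i, l) ω)|} ≤ 2 * q := by
    intro Y hY hYb hY0 a l
    refine (measureReal_lt_abs_sum_le (hind l) (fun i => hlaw (i, l)) hY hYb hY0 _ hδ0
      hδ).trans ?_
    rw [hq]
    gcongr
    exact hNa a
  have h1 := havg (fun x => x) measurable_id (fun x => by linarith) integral_id_laplaceMeasure
  have h2 := havg (fun x => |x| - 1) (by fun_prop)
    (fun x => (abs_sub _ _).trans (by simp)) (by
      rw [integral_sub integrable_abs_laplaceMeasure (integrable_const _),
        integral_abs_laplaceMeasure]; simp)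
  have h3 : ∀ l, P.real {ω | δ * N < ∑ i, max (|ε (i, l) ω| - s) 0} ≤ k * q := by
    intro l
    refine (measureReal_lt_sum_excess_le (hind l) (fun i => hlaw (i, l)) s _).trans ?_
    have hk' : (1 : ℝ) ≤ k := by exact_mod_cast hk
    -- By `hs` the exponent is at most δN/4 - δN/2 = -δN/4, and δ ≤ 1 makes this at most -δ²N/512.
    calc _ ≤ q := by
          rw [hq]
          apply Real.exp_le_exp.2
          nlinarith [mul_nonneg hδ0 hN, mul_le_mul_of_nonneg_left hδ (mul_nonneg hδ0 hN)]
      _ ≤ k * q := le_mul_of_one_le_left (Real.exp_pos _).le hk'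
  have hset : {ω | ¬ GoodNoise z (fun i l => ε (i, l) ω) δ s N} ⊆
      ((⋃ l, ⋃ a, {ω | δ * clusterSize z a < |∑ i with z i = a, ε (i, l) ω|}) ∪
      (⋃ l, ⋃ a, {ω | δ * clusterSize z a < |∑ i with z i = a, (|ε (i, l) ω| - 1)|})) ∪
      ⋃ l, {ω | δ * N < ∑ i, max (|ε (i, l) ω| - s) 0} := by
    intro ω hω
    by_contra h
    simp only [Set.mem_union, Set.mem_iUnion, Set.mem_ofPred_eq, not_or, not_exists,
      not_lt] at h
    exact hω ⟨fun a l => h.1.1 l a, fun a l => h.1.2 l a, h.2⟩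
  have u1 := measureReal_iUnion_fin_le _ fun l => measureReal_iUnion_fin_le _ fun a => h1 a l
  have u2 := measureReal_iUnion_fin_le _ fun l => measureReal_iUnion_fin_le _ fun a => h2 a l
  have u3 := measureReal_iUnion_fin_le _ h3
  have := (measureReal_mono hset (μ := P)).trans ((measureReal_union_le _ _).trans
    (add_le_add_left (measureReal_union_le _ _) _))
  linarith

/-- The threshold T is large enough that d - T/2 ≤ -C, so large noise is no likelier than a failed
test. Adding the union over the competing clusters gives 1 + k. -/
lemma measureReal_badPoint_le {ε : Fin d → Ω → ℝ} (hε : iIndepFun ε P)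
    (hlaw : ∀ l, HasLaw (ε l) (laplaceMeasure 0 1) P) {μ σ : Fin k → Fin d → ℝ}
    (hσ : ∀ a l, 0 < σ a l) (hC : 0 < chernoffFamily μ σ) {u T : ℝ} (hu : 0 ≤ u)
    (hT : 2 * (chernoffFamily μ σ + d) ≤ T) (a : Fin k) :
    P.real {ω | BadPoint μ σ T u a fun l => ε l ω} ≤
      (1 + k) * Real.exp (u - chernoffFamily μ σ) := by
  set C := chernoffFamily μ σ
  have h1 : P.real {ω | T ≤ ∑ l, |ε l ω|} ≤ Real.exp (u - C) :=
    (measureReal_le_sum_abs_le hε hlaw T).trans (Real.exp_le_exp.2 (by linarith))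
  have h2 : ∀ b, P.real {ω | b ≠ a ∧
      -u ≤ Real.log (laplaceVecPDF (μ b) (σ b) fun l => μ a l + σ a l * ε l ω) -
        Real.log (laplaceVecPDF (μ a) (σ a) fun l => μ a l + σ a l * ε l ω)} ≤
      Real.exp (u - C) := by
    intro b
    by_cases hb : b = a
    · simp [hb, Real.exp_nonneg]
    · have hCb := chernoffFamily_le (μ := μ) (σ := σ) hb
      simp only [ne_eq, hb, not_false_eq_true, true_and]
      exact (measureReal_le_log_ratio_le_chernoff hε hlaw (hσ b) (hσ a) hu
        (hC.trans_le hCb)).trans (Real.exp_le_exp.2 (by linarith))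
  have hset : {ω | BadPoint μ σ T u a fun l => ε l ω} = {ω | T ≤ ∑ l, |ε l ω|} ∪
      ⋃ b, {ω | b ≠ a ∧
      -u ≤ Real.log (laplaceVecPDF (μ b) (σ b) fun l => μ a l + σ a l * ε l ω) -
        Real.log (laplaceVecPDF (μ a) (σ a) fun l => μ a l + σ a l * ε l ω)} := by
    ext ω; simp [BadPoint]
  rw [hset]
  refine (measureReal_union_le _ _).trans ?_
  linarith [measureReal_iUnion_fin_le _ h2]

end Noise

/-! ### Relabelling, induction over iterations, finite-sample bound -/

lemma clusterSize_relabel {n k : ℕ} (τ : Equiv.Perm (Fin k)) (z : Fin n → Fin k) (a : Fin k) :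
    clusterSize (τ ∘ z) (τ a) = clusterSize z a := by
  simp [clusterSize]

lemma estLoc_relabel {n k d : ℕ} (x : Fin n → Fin d → ℝ) (τ : Equiv.Perm (Fin k))
    (z : Fin n → Fin k) (a : Fin k) : estLoc x (τ ∘ z) (τ a) = estLoc x z a := by
  ext l; simp [estLoc, clusterSize_relabel]

lemma estScale_relabel {n k d : ℕ} (x : Fin n → Fin d → ℝ) (τ : Equiv.Perm (Fin k))
    (z : Fin n → Fin k) (a : Fin k) : estScale x (τ ∘ z) (τ a) = estScale x z a := by
  ext l; simp [estScale, clusterSize_relabel, estLoc_relabel]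

/-- The algorithm is equivariant under permutations of the labels. The permutation that is optimal
for the initialisation can therefore be applied to the whole run, and only Hamming distances matter
afterwards. -/
lemma IsStep.relabel {n k d : ℕ} {x : Fin n → Fin d → ℝ} {z z' : Fin n → Fin k}
    (h : IsStep x z z') (τ : Equiv.Perm (Fin k)) : IsStep x (τ ∘ z) (τ ∘ z') := by
  intro hpos i b
  have := h (fun a l => by rw [← estScale_relabel x τ]; exact hpos _ l) i (τ.symm b)
  rwa [← estLoc_relabel x τ, ← estScale_relabel x τ, ← estLoc_relabel x τ z (z' i),
    ← estScale_relabel x τ z (z' i), Equiv.apply_symm_apply] at this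

lemma loss_le_hammingDist {n k : ℕ} (z z' : Fin n → Fin k) (τ : Equiv.Perm (Fin k)) :
    loss z z' ≤ hammingDist z (τ ∘ z') :=
  ciInf_le (OrderBot.bddBelow _) τ

lemma exists_hammingDist_eq_loss {n k : ℕ} (z z' : Fin n → Fin k) :
    ∃ τ : Equiv.Perm (Fin k), hammingDist z (τ ∘ z') = loss z z' :=
  exists_eq_ciInf_of_finite

/-- On regular noise with few bad points, all iterates of a run with a good initialisation err only
at bad points. -/
lemma GoodNoise.hammingDist_run_le {n k d : ℕ} {z : Fin n → Fin k} {e x : Fin n → Fin d → ℝ}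
    {μ σ : Fin k → Fin d → ℝ} {δ s N D σmin σmax T u M : ℝ} (he : GoodNoise z e δ s N)
    (hx : ∀ i l, x i l = μ (z i) l + σ (z i) l * e i l) (hσmin : 0 < σmin)
    (hσ : ∀ a l, σmin ≤ σ a l ∧ σ a l ≤ σmax) (hσmax : 0 ≤ σmax) (hD0 : 0 ≤ D)
    (hD : ∀ a b l, |μ a l - μ b l| ≤ D) (hN : 0 < N) (hNa : ∀ a, N ≤ clusterSize z a)
    (hδ0 : 0 ≤ δ) (hδ : δ ≤ 1 / 2) (hs : 0 ≤ s) (hr : 4 * (1 + 3 * σmax) * δ ≤ σmin / 2)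
    (hu : 2 * (4 * (1 + 3 * σmax) * δ) *
      (4 / σmin * d + 2 / σmin ^ 2 * (d * D + σmax * T)) ≤ u)
    (hbad : ∑ i, {y | BadPoint μ σ T u (z i) y}.indicator (1 : (Fin d → ℝ) → ℝ) (e i) ≤ M)
    (hM : M * (s + D + 1) ≤ δ * N) {w : ℕ → Fin n → Fin k} (hrun : IsRun x w)
    (h0 : hammingDist z (w 0) * (s + D + 1) ≤ δ * N) (t : ℕ) :
    hammingDist z (w (t + 1)) ≤ M := by
  have hstep : ∀ t, hammingDist z (w t) * (s + D + 1) ≤ δ * N →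
      (hammingDist z (w (t + 1)) : ℝ) ≤ M := by
    intro t ht
    have hest := fun a l => he.abs_est_sub_le hx (fun a l => hσmin.trans_le (hσ a l).1)
      (fun a l => (hσ a l).2) hD0 hD hN hNa hδ0 hδ hs ht a l
    refine le_trans ?_ hbad
    rw [hammingDist_eq_sum, Finset.sum_filter]
    refine Finset.sum_le_sum fun i _ => ?_
    split_ifs with hi
    · have := badPoint_of_isStep hx hσmin hσ hσmax hD (by positivity) hr
        (fun a l => (hest a l).1) (fun a l => (hest a l).2) hu (hrun t) hi
      rw [Set.indicator_of_mem (by exact this)]; simp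
    · exact Set.indicator_nonneg (by simp) _
  induction t with
  | zero => exact hstep 0 h0
  | succ t ih =>
    -- The number of bad points again meets the requirement on a starting labelling, and the same
    -- set of bad points bounds every step, so errors do not accumulate.
    refine hstep (t + 1) (le_trans ?_ hM)
    gcongr

/-- The finite-sample error bound for the iterates. -/
lemma measure_not_loss_le {Ω : Type*} [MeasurableSpace Ω] {n k d : ℕ} {P : Measure Ω}
    [IsProbabilityMeasure P] {z : Fin n → Fin k} {μ σ : Fin k → Fin d → ℝ}
    {X : Ω → Fin n → Fin d → ℝ} (hX : IsLaplaceMixture P z μ σ X) (hn : 0 < n) (hk : 1 ≤ k)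
    {zhat : Ω → ℕ → Fin n → Fin k} (hrun : ∀ ω, IsRun (X ω) (zhat ω))
    {σmin σmax δ s N η H : ℝ} (hσmin : 0 < σmin)
    (hσ : ∀ a l, σmin ≤ σ a l ∧ σ a l ≤ σmax) (hσmax : 0 ≤ σmax) (hN : 0 < N)
    (hNa : ∀ a, N ≤ clusterSize z a) (hδ0 : 0 ≤ δ) (hδ : δ ≤ 1 / 2) (hs : 0 ≤ s)
    (hs' : 2 * n * Real.exp (-(s / 2)) ≤ δ * N / 4)
    (hr : 4 * (1 + 3 * σmax) * δ ≤ σmin / 2) (hC : 0 < chernoffFamily μ σ) (hη : 0 ≤ η)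
    (hu : 2 * (4 * (1 + 3 * σmax) * δ) * (4 / σmin * d + 2 / σmin ^ 2 *
      (d * maxSep μ + σmax * (2 * (chernoffFamily μ σ + d)))) ≤ η / 2 * chernoffFamily μ σ)
    (hM : n * Real.exp (-(1 - η) * chernoffFamily μ σ) * (s + maxSep μ + 1) ≤ δ * N)
    (hH : H * (s + maxSep μ + 1) ≤ δ * N) :
    P {ω | ¬ ∀ t : ℕ, 1 ≤ t → (n : ℝ)⁻¹ * (loss z (zhat ω t) : ℝ) ≤
        Real.exp (-(1 - η) * chernoffFamily μ σ)} ≤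
      ENNReal.ofReal (5 * ((d * k) * Real.exp (-(δ ^ 2 / 512 * N)))) +
      P {ω | H < (loss z (zhat ω 0) : ℝ)} +
      ENNReal.ofReal ((1 + k) * Real.exp (-(η / 2) * chernoffFamily μ σ)) := by
  obtain ⟨ε, hε, hlaw, hXε⟩ := hX
  set C := chernoffFamily μ σ with hCdef
  set M : ℝ := n * Real.exp (-(1 - η) * C) with hMdef
  have hn' : (0 : ℝ) < n := by exact_mod_cast hn
  have hMpos : 0 < M := by positivity
  have hD0 := maxSep_nonneg μ
  set A : Fin n → Set Ω := fun i =>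
    {ω | BadPoint μ σ (2 * (C + d)) (η / 2 * C) (z i) fun l => ε (i, l) ω} with hA
  have hPA : ∀ i, P.real (A i) ≤ (1 + k) * Real.exp (η / 2 * C - C) := fun i =>
    measureReal_badPoint_le (hε.precomp (g := fun l => (i, l)) fun l j h => (Prod.ext_iff.1 h).2)
      (fun l => hlaw (i, l)) (fun a l => hσmin.trans_le (hσ a l).1) hC (by positivity) le_rfl (z i)
  -- The expected number of bad points is at most n (1 + k) exp(-(1 - η/2) C). The other half of η
  -- makes `M` larger by exp(ηC/2) / (1 + k), and Markov's inequality uses this room.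
  have hcount : P.real {ω | M < ∑ i, (A i).indicator 1 ω} ≤
      (1 + k) * Real.exp (-(η / 2) * C) := by
    have h := measureReal_lt_card_mul_le A hMpos.le hPA
    rw [← le_div_iff₀ hMpos] at h
    refine h.trans (le_of_eq ?_)
    rw [div_eq_iff hMpos.ne', hMdef]
    have : Real.exp (η / 2 * C - C) = Real.exp (-(η / 2) * C) * Real.exp (-(1 - η) * C) := by
      rw [← Real.exp_add]; congr 1; ring
    rw [this]; ring
  have hgood := measureReal_not_goodNoise_le hε hlaw z hk hδ0 (by linarith) hN.le hNa hs'
  have hset : {ω | ¬ ∀ t : ℕ, 1 ≤ t → (n : ℝ)⁻¹ * (loss z (zhat ω t) : ℝ) ≤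
        Real.exp (-(1 - η) * C)} ⊆
      ({ω | ¬ GoodNoise z (fun i l => ε (i, l) ω) δ s N} ∪
        {ω | H < (loss z (zhat ω 0) : ℝ)}) ∪ {ω | M < ∑ i, (A i).indicator 1 ω} := by
    intro ω hω
    by_contra h
    simp only [Set.mem_union, Set.mem_ofPred_eq, not_or, not_not, not_lt] at h
    obtain ⟨⟨hg, hl⟩, hb⟩ := h
    apply hω
    intro t ht
    obtain ⟨t, rfl⟩ : ∃ t', t = t' + 1 := ⟨t - 1, by omega⟩
    obtain ⟨τ, hτ⟩ := exists_hammingDist_eq_loss z (zhat ω 0)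
    have hham := hg.hammingDist_run_le (hXε ω) hσmin hσ hσmax hD0 (abs_sub_le_maxSep μ) hN hNa
      hδ0 hδ hs hr hu (M := M) hb hM
      (w := fun t => τ ∘ zhat ω t) (fun t => (hrun ω t).relabel τ) (by
        rw [hτ]
        refine le_trans ?_ hH
        gcongr) t
    rw [inv_mul_le_iff₀ hn']
    exact le_trans (by exact_mod_cast loss_le_hammingDist z _ τ) hham
  refine (measure_mono hset).trans ((measure_union_le _ _).trans (add_le_add
    ((measure_union_le _ _).trans (add_le_add ?_ le_rfl)) ?_))
  · rw [← ofReal_measureReal]; exact ENNReal.ofReal_le_ofReal hgood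
  · rw [← ofReal_measureReal]; exact ENNReal.ofReal_le_ofReal hcount

/-- One value of t suffices: at t = 1/2 weighted AM-GM bounds each coordinate integral by 1. -/
lemma chernoff_nonneg {d : ℕ} {m σ m' σ' : Fin d → ℝ} (hσ : ∀ l, 0 < σ l)
    (hσ' : ∀ l, 0 < σ' l) : 0 ≤ chernoff volume (laplaceVecPDF m σ) (laplaceVecPDF m' σ') := by
  have hnn : ∀ t : Set.Ioo (0 : ℝ) 1,
      0 ≤ ∫ x, laplaceVecPDF m σ x ^ (t : ℝ) * laplaceVecPDF m' σ' x ^ (1 - (t : ℝ)) :=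
    fun t => integral_nonneg fun x => mul_nonneg
      (Real.rpow_nonneg (Finset.prod_nonneg fun l _ => (laplacePDF_pos (hσ l) _).le) _)
      (Real.rpow_nonneg (Finset.prod_nonneg fun l _ => (laplacePDF_pos (hσ' l) _).le) _)
  rw [chernoff, neg_nonneg]
  refine Real.log_nonpos (Real.iInf_nonneg hnn) ?_
  set t : Set.Ioo (0 : ℝ) 1 := ⟨1 / 2, by norm_num⟩
  refine (ciInf_le ⟨0, by rintro _ ⟨t, rfl⟩; exact hnn t⟩ t).trans ?_
  rw [integral_laplaceVecPDF_rpow_mul hσ hσ']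
  refine Finset.prod_le_one (fun l _ => integral_nonneg fun x => mul_nonneg
    (Real.rpow_nonneg (laplacePDF_pos (hσ l) _).le _)
    (Real.rpow_nonneg (laplacePDF_pos (hσ' l) _).le _)) fun l _ => ?_
  have h1 := (integrable_laplacePDF (m := m l) (hσ l)).const_mul (t : ℝ)
  have h2 := (integrable_laplacePDF (m := m' l) (hσ' l)).const_mul (1 - (t : ℝ))
  calc _ ≤ ∫ x, ((t : ℝ) * laplacePDF (m l) (σ l) x +
        (1 - (t : ℝ)) * laplacePDF (m' l) (σ' l) x) :=
      integral_mono (integrable_laplacePDF_rpow_mul (hσ l) (hσ' l) t.2) (h1.add h2) fun x =>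
        Real.geom_mean_le_arith_mean2_weighted t.2.1.le (by linarith [t.2.2])
          (laplacePDF_pos (hσ l) _).le (laplacePDF_pos (hσ' l) _).le (by ring)
    _ = 1 := by
      rw [integral_add h1 h2, integral_const_mul, integral_const_mul, integral_laplacePDF (hσ l),
        integral_laplacePDF (hσ' l)]; ring

lemma chernoffFamily_nonneg {k d : ℕ} {μ σ : Fin k → Fin d → ℝ} (hσ : ∀ a l, 0 < σ a l) :
    0 ≤ chernoffFamily μ σ :=
  Real.iInf_nonneg fun _ => chernoff_nonneg (hσ _) (hσ _)

end LaplaceMixture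

/-! ### Null sequences and growth of n / k -/

lemma Filter.Tendsto.pow_mul_exp_neg_mul {ι : Type*} {f : Filter ι} {C : ι → ℝ}
    (hC : Tendsto C f atTop) (p : ℕ) {b : ℝ} (hb : 0 < b) :
    Tendsto (fun n => C n ^ p * Real.exp (-b * C n)) f (𝓝 0) := by
  have h := ((Real.tendsto_pow_mul_exp_neg_atTop_nhds_zero p).comp
    (hC.const_mul_atTop hb)).const_mul ((b ^ p)⁻¹)
  rw [mul_zero] at h
  refine h.congr fun n => ?_
  simp only [Function.comp, mul_pow, neg_mul]
  rw [← mul_assoc, inv_mul_cancel_left₀ (pow_ne_zero p hb.ne')]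

/-- A family of null sequences indexed by small parameters has a null diagonal. -/
lemma exists_tendsto_diagonal {p : ℝ → ℕ → ENNReal} {r : ℝ} (hr : 0 < r)
    (hp : ∀ η, 0 < η → η ≤ r → Tendsto (p η) atTop (𝓝 0)) :
    ∃ η : ℕ → ℝ, Tendsto η atTop (𝓝 0) ∧ Tendsto (fun n => p (η n) n) atTop (𝓝 0) := by
  classical
  set a : ℕ → ℝ := fun m => r / (m + 1) with ha
  have ha0 : ∀ m, 0 < a m := fun m => by positivity
  have har : ∀ m, a m ≤ r := fun m =>
    div_le_self hr.le (by linarith [(Nat.cast_nonneg m : (0 : ℝ) ≤ m)])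
  -- The diagonal index `M n` is the largest m ≤ n for which the m-th family stays below 1/m from n
  -- onwards. The default value 0 does no harm, since `M` tends to infinity.
  set G : ℕ → ℕ → Prop := fun n m => ∀ n', n ≤ n' → p (a m) n' ≤ ((m : ENNReal))⁻¹ with hG
  set M : ℕ → ℕ := fun n => Nat.findGreatest (G n) n with hM
  have hMtop : Tendsto M atTop atTop := by
    refine tendsto_atTop.2 fun m => ?_
    have hev : ∀ᶠ n in atTop, p (a m) n ≤ ((m : ENNReal))⁻¹ :=
      (hp _ (ha0 m) (har m)).eventually_le_const (by simp)
    obtain ⟨n₀, hn₀⟩ := eventually_atTop.1 hev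
    filter_upwards [eventually_ge_atTop (max m n₀)] with n hn
    exact Nat.le_findGreatest ((le_max_left _ _).trans hn) fun n' hn' =>
      hn₀ n' (((le_max_right _ _).trans hn).trans hn')
  refine ⟨fun n => a (M n), ?_, ?_⟩
  · have : Tendsto a atTop (𝓝 0) :=
      tendsto_const_nhds.div_atTop (tendsto_natCast_atTop_atTop.atTop_add tendsto_const_nhds)
    exact this.comp hMtop
  · refine tendsto_of_tendsto_of_tendsto_of_le_of_le' tendsto_const_nhds
      (ENNReal.tendsto_inv_nat_nhds_zero.comp hMtop) (Eventually.of_forall fun _ => zero_le) ?_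
    filter_upwards [hMtop.eventually_ge_atTop 1] with n hn
    exact Nat.findGreatest_of_ne_zero (P := G n) (n := n) rfl (by
      change M n ≠ 0; omega) n le_rfl

/-- Since dk ≥ 2, one of the two logarithmic factors is at least log 2 and can be dropped. -/
lemma eventually_log_mul_le_div {k d : ℕ → ℕ} (hk : ∀ n, 2 ≤ k n) (hd : ∀ n, 1 ≤ d n)
    (hkd : (fun n => (k n : ℝ) * Real.log ((d n : ℝ) * (k n : ℝ)) ^ 2) =o[atTop] fun n => (n : ℝ))
    {b : ℝ} (hb : 0 < b) :
    ∀ᶠ n : ℕ in atTop, Real.log ((d n : ℝ) * (k n : ℝ)) ≤ b * ((n : ℝ) / k n) := by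
  have h2 : 0 < Real.log 2 := Real.log_pos one_lt_two
  filter_upwards [hkd.def (mul_pos hb h2)] with n hn
  have hk' : (2 : ℝ) ≤ k n := by exact_mod_cast hk n
  have hd' : (1 : ℝ) ≤ d n := by exact_mod_cast hd n
  have hL : Real.log 2 ≤ Real.log ((d n : ℝ) * (k n : ℝ)) :=
    Real.log_le_log two_pos (by nlinarith)
  rw [Real.norm_eq_abs, Real.norm_eq_abs, abs_of_nonneg (by positivity),
    abs_of_nonneg (Nat.cast_nonneg n)] at hn
  rw [← mul_div_assoc, le_div_iff₀ (by linarith)]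
  have : Real.log 2 * (Real.log ((d n : ℝ) * (k n : ℝ)) * k n) ≤ Real.log 2 * (b * n) := by
    have : 0 ≤ Real.log ((d n : ℝ) * (k n : ℝ)) * k n := by
      apply mul_nonneg <;> linarith
    nlinarith
  exact le_of_mul_le_mul_left this h2

lemma tendsto_div_clusters {k d : ℕ → ℕ} (hk : ∀ n, 2 ≤ k n) (hd : ∀ n, 1 ≤ d n)
    (hkd : (fun n => (k n : ℝ) * Real.log ((d n : ℝ) * (k n : ℝ)) ^ 2) =o[atTop] fun n => (n : ℝ)) :
    Tendsto (fun n : ℕ => (n : ℝ) / k n) atTop atTop := by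
  have h2 : 0 < Real.log 2 := Real.log_pos one_lt_two
  refine tendsto_atTop.2 fun B => ?_
  filter_upwards [eventually_log_mul_le_div hk hd hkd
    (by positivity : 0 < Real.log 2 / (|B| + 1))] with n hn
  have hk' : (2 : ℝ) ≤ k n := by exact_mod_cast hk n
  have hd' : (1 : ℝ) ≤ d n := by exact_mod_cast hd n
  have hL : Real.log 2 ≤ Real.log ((d n : ℝ) * (k n : ℝ)) :=
    Real.log_le_log two_pos (by nlinarith)
  have h3 := hL.trans hn
  rw [div_mul_eq_mul_div, le_div_iff₀ (by positivity)] at h3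
  have := le_of_mul_le_mul_left h3 h2
  linarith [le_abs_self B]

/-- This pays for the union bound over coordinates and clusters: half of the exponent absorbs dk,
the other half still tends to infinity. -/
lemma tendsto_mul_exp_neg_div {k d : ℕ → ℕ} (hk : ∀ n, 2 ≤ k n) (hd : ∀ n, 1 ≤ d n)
    (hkd : (fun n => (k n : ℝ) * Real.log ((d n : ℝ) * (k n : ℝ)) ^ 2) =o[atTop] fun n => (n : ℝ))
    {b : ℝ} (hb : 0 < b) :
    Tendsto (fun n : ℕ => ((d n : ℝ) * k n) * Real.exp (-(b * ((n : ℝ) / k n)))) atTop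
      (𝓝 0) := by
  have h := (tendsto_div_clusters hk hd hkd).pow_mul_exp_neg_mul 0 (half_pos hb)
  simp only [pow_zero, one_mul] at h
  refine tendsto_of_tendsto_of_tendsto_of_le_of_le' tendsto_const_nhds h
    (Eventually.of_forall fun n => by positivity) ?_
  filter_upwards [eventually_log_mul_le_div hk hd hkd (half_pos hb)] with n hn
  have hk' : (2 : ℝ) ≤ k n := by exact_mod_cast hk n
  have hd' : (1 : ℝ) ≤ d n := by exact_mod_cast hd n
  rw [← Real.exp_log (by positivity : 0 < (d n : ℝ) * k n), ← Real.exp_add]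
  exact Real.exp_le_exp.2 (by linarith)

namespace LaplaceMixture

/-! ### The asymptotic regime for a fixed loss in the exponent -/

section Asymptotics

variable {k d : ℕ → ℕ} {μ σ : ∀ n, Fin (k n) → Fin (d n) → ℝ} {σmin σmax : ℝ}

lemma eventually_le_chernoffFamily (hσ0 : ∀ n a l, 0 < σ n a l)
    (hC : (fun n => (d n : ℝ) * √(k n : ℝ) * (1 + maxSep (μ n) / √((n : ℝ) / (k n : ℝ))))
      =o[atTop] fun n => chernoffFamily (μ n) (σ n)) {M : ℝ} (hM : 0 < M) :
    ∀ᶠ n in atTop, M * (d n * √(k n : ℝ)) ≤ chernoffFamily (μ n) (σ n) := by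
  filter_upwards [hC.def (inv_pos.2 hM)] with n hn
  have h0 := chernoffFamily_nonneg (μ := μ n) (hσ0 n)
  have hD := maxSep_nonneg (μ n)
  rw [Real.norm_eq_abs, Real.norm_eq_abs, abs_of_nonneg (by positivity), abs_of_nonneg h0,
    ← div_eq_inv_mul, le_div_iff₀ hM] at hn
  refine le_trans ?_ hn
  rw [mul_comm]
  refine mul_le_mul_of_nonneg_right (le_mul_of_one_le_right (by positivity) ?_) hM.le
  linarith [div_nonneg hD (Real.sqrt_nonneg ((n : ℝ) / (k n : ℝ)))]

/-- Dividing C ≤ d (const + D / σmin) by d transfers the growth of C / (d √k) to D / √k. As a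
consequence D dominates truncation levels of order log k. -/
lemma eventually_le_maxSep (hk : ∀ n, 2 ≤ k n) (hd : ∀ n, 1 ≤ d n) (hσmin : 0 < σmin)
    (hmm : σmin ≤ σmax) (hσ : ∀ n a l, σmin ≤ σ n a l ∧ σ n a l ≤ σmax)
    (hC : ∀ M : ℝ, 0 < M →
      ∀ᶠ n in atTop, M * (d n * √(k n : ℝ)) ≤ chernoffFamily (μ n) (σ n)) {M : ℝ} (hM : 0 < M) :
    ∀ᶠ n in atTop, M * √(k n : ℝ) ≤ maxSep (μ n) := by
  have hL : 0 ≤ Real.log (σmax / σmin) := Real.log_nonneg ((one_le_div hσmin).2 hmm)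
  filter_upwards [hC (Real.log (σmax / σmin) + M / σmin) (by positivity)] with n hn
  have h1 := hn.trans (chernoffFamily_le_maxSep (hk n) hσmin hmm (hσ n))
  have hd' : (1 : ℝ) ≤ d n := by exact_mod_cast hd n
  have hk' : (1 : ℝ) ≤ √(k n : ℝ) := Real.one_le_sqrt.2 (by exact_mod_cast (by linarith [hk n]))
  have h2 : (Real.log (σmax / σmin) + M / σmin) * √(k n : ℝ) ≤
      Real.log (σmax / σmin) + maxSep (μ n) / σmin :=
    le_of_mul_le_mul_left (by linarith) (by linarith : (0 : ℝ) < d n)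
  have h3 : M / σmin * √(k n : ℝ) ≤ maxSep (μ n) / σmin := by nlinarith
  rwa [div_mul_eq_mul_div, div_le_div_iff_of_pos_right hσmin] at h3

lemma exists_eventually_mul_maxSep_le (hd : ∀ n, 1 ≤ d n) (hσ0 : ∀ n a l, 0 < σ n a l)
    (hΔ : (fun n => maxSep (μ n)) =O[atTop] fun n => (d n : ℝ)⁻¹ * chernoffFamily (μ n) (σ n)) :
    ∃ K : ℝ, 0 < K ∧
      ∀ᶠ n in atTop, d n * maxSep (μ n) ≤ K * chernoffFamily (μ n) (σ n) := by
  obtain ⟨K, hK, h⟩ := hΔ.exists_pos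
  refine ⟨K, hK, ?_⟩
  filter_upwards [h.bound] with n hn
  have h0 := chernoffFamily_nonneg (μ := μ n) (hσ0 n)
  have hd' : (0 : ℝ) < d n := by exact_mod_cast hd n
  rw [Real.norm_eq_abs, Real.norm_eq_abs, abs_of_nonneg (maxSep_nonneg _),
    abs_of_nonneg (by positivity)] at hn
  calc d n * maxSep (μ n) ≤ d n * (K * ((d n : ℝ)⁻¹ * chernoffFamily (μ n) (σ n))) := by gcongr
    _ = _ := by field_simp

/-- `Q` stands for the factor by which the perturbation bound exceeds a multiple of C. The accuracy
is a constant, not a null sequence, so neither a rate for the estimates nor a contraction argument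
is needed. -/
lemma exists_small_accuracy {σmin σmax Q η : ℝ} (hσmin : 0 < σmin) (hσmax : 0 ≤ σmax)
    (hQ : 0 < Q) (hη : 0 < η) : ∃ δ : ℝ, 0 < δ ∧ δ ≤ 1 / 2 ∧
      4 * (1 + 3 * σmax) * δ ≤ σmin / 2 ∧ 2 * (4 * (1 + 3 * σmax) * δ) * Q ≤ η / 2 := by
  set R := 4 * (1 + 3 * σmax) with hR
  have hR0 : 0 < R := by positivity
  refine ⟨min (1 / 2) (min (σmin / 2 / R) (η / 2 / (2 * R * Q))), by positivity,
    min_le_left _ _, ?_, ?_⟩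
  · rw [mul_comm, ← le_div_iff₀ hR0]
    exact (min_le_right _ _).trans (min_le_left _ _)
  · have : min (1 / 2) (min (σmin / 2 / R) (η / 2 / (2 * R * Q))) ≤ η / 2 / (2 * R * Q) :=
      (min_le_right _ _).trans (min_le_right _ _)
    rw [le_div_iff₀ (by positivity)] at this
    linarith

/-- For a fixed loss `η` in the exponent, with high probability all iterates achieve the error
rate. -/
lemma tendsto_measure_not_loss_le
    (hk : ∀ n, 2 ≤ k n) (hd : ∀ n, 1 ≤ d n) {z : ∀ n, Fin n → Fin (k n)} (hσmin : 0 < σmin)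
    (hσ : ∀ n a l, σmin ≤ σ n a l ∧ σ n a l ≤ σmax)
    {Ω : ℕ → Type*} [∀ n, MeasurableSpace (Ω n)]
    {P : ∀ n, Measure (Ω n)} [∀ n, IsProbabilityMeasure (P n)]
    {X : ∀ n, Ω n → Fin n → Fin (d n) → ℝ}
    (hX : ∀ n, IsLaplaceMixture (P n) (z n) (μ n) (σ n) (X n))
    (hkd : (fun n => (k n : ℝ) * Real.log ((d n : ℝ) * (k n : ℝ)) ^ 2)
      =o[atTop] fun n => (n : ℝ))
    {α : ℝ} (hα : 0 < α)
    (hbal : ∀ᶠ n : ℕ in atTop, ∀ a, α * ((n : ℝ) / (k n : ℝ)) ≤ (clusterSize (z n) a : ℝ))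
    (hΔ : (fun n => maxSep (μ n)) =O[atTop] fun n => (d n : ℝ)⁻¹ * chernoffFamily (μ n) (σ n))
    (hC : (fun n => (d n : ℝ) * √(k n : ℝ) * (1 + maxSep (μ n) / √((n : ℝ) / (k n : ℝ))))
      =o[atTop] fun n => chernoffFamily (μ n) (σ n))
    {zhat : ∀ n, Ω n → ℕ → Fin n → Fin (k n)} (hrun : ∀ n ω, IsRun (X n ω) (zhat n ω))
    (hinit : ∀ η : ℝ, 0 < η → Tendsto (fun n => P n {ω |
      η * ((n : ℝ) * (k n : ℝ)⁻¹ * (maxSep (μ n))⁻¹) < (loss (z n) (zhat n ω 0) : ℝ)})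
      atTop (𝓝 0)) {η : ℝ} (hη : 0 < η) (hη' : η ≤ 1 / 2) :
    Tendsto (fun n => P n {ω | ¬ ∀ t : ℕ, 1 ≤ t → (n : ℝ)⁻¹ * (loss (z n) (zhat n ω t) : ℝ) ≤
      Real.exp (-(1 - η) * chernoffFamily (μ n) (σ n))}) atTop (𝓝 0) := by
  have hσ0 : ∀ n a l, 0 < σ n a l := fun n a l => hσmin.trans_le (hσ n a l).1
  have hmm : σmin ≤ σmax :=
    (hσ 0 ⟨0, by linarith [hk 0]⟩ ⟨0, hd 0⟩).1.trans (hσ 0 _ _).2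
  have hσmax : 0 < σmax := hσmin.trans_le hmm
  have hk1 : ∀ n, (1 : ℝ) ≤ √(k n : ℝ) := fun n =>
    Real.one_le_sqrt.2 (by exact_mod_cast (by linarith [hk n]))
  have hd1 : ∀ n, (1 : ℝ) ≤ d n := fun n => by exact_mod_cast hd n
  have hClarge := fun M (hM : 0 < M) => eventually_le_chernoffFamily hσ0 hC hM
  have hDlarge := fun M (hM : 0 < M) => eventually_le_maxSep hk hd hσmin hmm hσ hClarge hM
  have hCtop : Tendsto (fun n => chernoffFamily (μ n) (σ n)) atTop atTop := by
    refine tendsto_atTop.2 fun b => ?_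
    filter_upwards [hClarge (|b| + 1) (by positivity)] with n hn
    have : 1 ≤ d n * √(k n : ℝ) := one_le_mul_of_one_le_of_one_le (hd1 n) (hk1 n)
    nlinarith [le_abs_self b, abs_nonneg b]
  obtain ⟨K, hK, hDC⟩ := exists_eventually_mul_maxSep_le hd hσ0 hΔ
  obtain ⟨δ, hδ0, hδ, hδr, hδu⟩ := exists_small_accuracy hσmin hσmax.le
    (by positivity : 0 < 4 / σmin + 2 / σmin ^ 2 * (K + 4 * σmax)) hη
  -- With exp(-s/2) = 1/(kB) and N = αn/k, the required bound 2n exp(-s/2) ≤ δN/4 amounts to B ≥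
  -- 8/(δα). The added 1 ensures s ≥ 0.
  set B : ℝ := 8 / (δ * α) + 1 with hB
  have hB1 : 1 ≤ B := by rw [hB]; linarith [show 0 < 8 / (δ * α) by positivity]
  set s : ℕ → ℝ := fun n => 2 * Real.log (k n * B) with hs
  have hkB : ∀ n, 1 ≤ (k n : ℝ) * B := fun n =>
    one_le_mul_of_one_le_of_one_le (by exact_mod_cast (by linarith [hk n])) hB1
  have hs0 : ∀ n, 0 ≤ s n := fun n => mul_nonneg zero_le_two (Real.log_nonneg (hkB n))
  have hsD : ∀ᶠ n in atTop, s n + 1 ≤ maxSep (μ n) := by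
    -- From log k = 2 log √k ≤ 2√k one gets s + 1 ≤ 4√k + 2 log B + 1, whence the constant 5 + 2 log
    -- B.
    filter_upwards [hDlarge (5 + 2 * Real.log B) (by linarith [Real.log_nonneg hB1])] with n hn
    refine le_trans ?_ hn
    have hk0 : (0 : ℝ) < k n := by exact_mod_cast (by linarith [hk n])
    have h1 : Real.log (k n) ≤ 2 * √(k n : ℝ) := by
      have := Real.log_le_sub_one_of_pos (Real.sqrt_pos.2 hk0)
      rw [Real.log_sqrt hk0.le] at this
      linarith
    rw [hs]
    simp only
    rw [Real.log_mul hk0.ne' (by linarith)]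
    nlinarith [hk1 n, Real.log_nonneg hB1]
  have hkC : ∀ᶠ n in atTop, (k n : ℝ) ≤ chernoffFamily (μ n) (σ n) ^ 2 := by
    filter_upwards [hClarge 1 one_pos] with n hn
    have : √(k n : ℝ) ≤ chernoffFamily (μ n) (σ n) := by nlinarith [hk1 n, hd1 n]
    calc (k n : ℝ) = √(k n : ℝ) ^ 2 := (Real.sq_sqrt (Nat.cast_nonneg _)).symm
      _ ≤ _ := by gcongr
  have hdC : ∀ᶠ n in atTop, (d n : ℝ) ≤ chernoffFamily (μ n) (σ n) := by
    filter_upwards [hClarge 1 one_pos] with n hn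
    nlinarith [hk1 n, hd1 n]
  -- The cube collects k ≤ C² and s + D + 1 ≤ 2D ≤ 2KC; the exponent 1/2 is available because η ≤
  -- 1/2.
  have hsmall : ∀ᶠ n in atTop, 2 * K * (chernoffFamily (μ n) (σ n) ^ 3 *
      Real.exp (-(1 / 2) * chernoffFamily (μ n) (σ n))) ≤ δ * α := by
    have := (hCtop.pow_mul_exp_neg_mul 3 (by norm_num : (0 : ℝ) < 1 / 2)).const_mul (2 * K)
    rw [mul_zero] at this
    exact this.eventually_le_const (by positivity)
  have hbound : ∀ᶠ n in atTop, P n {ω | ¬ ∀ t : ℕ, 1 ≤ t →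
      (n : ℝ)⁻¹ * (loss (z n) (zhat n ω t) : ℝ) ≤
        Real.exp (-(1 - η) * chernoffFamily (μ n) (σ n))} ≤
      ENNReal.ofReal (5 * ((d n * k n) *
        Real.exp (-(δ ^ 2 / 512 * (α * ((n : ℝ) / k n)))))) +
      P n {ω | δ * α / 2 * ((n : ℝ) * (k n : ℝ)⁻¹ * (maxSep (μ n))⁻¹) <
        (loss (z n) (zhat n ω 0) : ℝ)} +
      ENNReal.ofReal ((1 + k n) * Real.exp (-(η / 2) * chernoffFamily (μ n) (σ n))) := by
    filter_upwards [eventually_gt_atTop 0, hbal, hsD, hkC, hdC, hsmall, hDC,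
      hDlarge 1 one_pos, hCtop.eventually_ge_atTop 1] with n hn hbal hsD hkC hdC hsmall hDC hD1 hC1
    set C := chernoffFamily (μ n) (σ n)
    set D := maxSep (μ n)
    have hk0 : (0 : ℝ) < k n := by linarith [Real.sqrt_pos.1 ((zero_lt_one).trans_le (hk1 n))]
    have hn0 : (0 : ℝ) < n := by exact_mod_cast hn
    have hD0 : 0 < D := by linarith [hk1 n]
    have hdn := hd1 n
    refine measure_not_loss_le (hX n) hn (by linarith [hk n]) (hrun n) hσmin (hσ n) hσmax.le
      (by positivity) hbal hδ0.le hδ (hs0 n) ?_ hδr (by linarith) hη.le ?_ ?_ ?_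
    · have h1 : Real.exp (-(s n / 2)) = (k n * B)⁻¹ := by
        rw [hs]
        simp only
        rw [mul_div_cancel_left₀ _ two_ne_zero, Real.exp_neg,
          Real.exp_log (by linarith [hkB n])]
      have h2 : B⁻¹ ≤ δ * α / 8 := by
        rw [inv_le_comm₀ (by linarith) (by positivity), inv_div, hB]; linarith
      rw [h1, mul_inv]
      calc 2 * (n : ℝ) * ((k n : ℝ)⁻¹ * B⁻¹) ≤ 2 * (n : ℝ) * ((k n : ℝ)⁻¹ * (δ * α / 8)) := by
            gcongr
        _ = _ := by ring
    · calc 2 * (4 * (1 + 3 * σmax) * δ) *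
            (4 / σmin * d n + 2 / σmin ^ 2 * (d n * D + σmax * (2 * (C + d n))))
          ≤ 2 * (4 * (1 + 3 * σmax) * δ) *
            (4 / σmin * C + 2 / σmin ^ 2 * (K * C + σmax * (2 * (C + C)))) := by gcongr
        _ = 2 * (4 * (1 + 3 * σmax) * δ) *
            (4 / σmin + 2 / σmin ^ 2 * (K + 4 * σmax)) * C := by ring
        _ ≤ _ := by gcongr
    · have hDK : D ≤ K * C := by nlinarith
      have h1 : Real.exp (-(1 - η) * C) ≤ Real.exp (-(1 / 2) * C) :=
        Real.exp_le_exp.2 (by nlinarith)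
      calc n * Real.exp (-(1 - η) * C) * (s n + D + 1)
          ≤ n * Real.exp (-(1 / 2) * C) * (2 * (K * C)) := by
            gcongr
            · linarith [hs0 n]
            · linarith
        _ = (n : ℝ) / k n * (k n * Real.exp (-(1 / 2) * C) * (2 * (K * C))) := by
            field_simp
        _ ≤ (n : ℝ) / k n * (C ^ 2 * Real.exp (-(1 / 2) * C) * (2 * (K * C))) := by gcongr
        _ = (n : ℝ) / k n * (2 * K * (C ^ 3 * Real.exp (-(1 / 2) * C))) := by ring
        _ ≤ (n : ℝ) / k n * (δ * α) := by gcongr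
        _ = _ := by ring
    -- The factor 1/2 in the admissible initial loss compensates s + D + 1 ≤ 2D.
    · calc δ * α / 2 * ((n : ℝ) * (k n : ℝ)⁻¹ * D⁻¹) * (s n + D + 1)
          ≤ δ * α / 2 * ((n : ℝ) * (k n : ℝ)⁻¹ * D⁻¹) * (2 * D) := by gcongr; linarith
        _ = _ := by field_simp
  have t1 : Tendsto (fun n : ℕ => ENNReal.ofReal (5 * ((d n * k n) *
      Real.exp (-(δ ^ 2 / 512 * (α * ((n : ℝ) / k n))))))) atTop (𝓝 0) := by
    have h := (tendsto_mul_exp_neg_div hk hd hkd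
      (by positivity : 0 < δ ^ 2 / 512 * α)).const_mul 5
    rw [mul_zero] at h
    have h := ENNReal.tendsto_ofReal h
    rw [ENNReal.ofReal_zero] at h
    simpa only [mul_assoc] using h
  have t3 : Tendsto (fun n => ENNReal.ofReal
      ((1 + k n) * Real.exp (-(η / 2) * chernoffFamily (μ n) (σ n)))) atTop (𝓝 0) := by
    have h := (hCtop.pow_mul_exp_neg_mul 0 (half_pos hη)).add
      (hCtop.pow_mul_exp_neg_mul 2 (half_pos hη))
    rw [add_zero] at h
    have h := ENNReal.tendsto_ofReal h
    rw [ENNReal.ofReal_zero] at h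
    refine tendsto_of_tendsto_of_tendsto_of_le_of_le' tendsto_const_nhds h
      (Eventually.of_forall fun _ => zero_le) ?_
    filter_upwards [hkC] with n hn
    refine ENNReal.ofReal_le_ofReal ?_
    rw [← add_mul, pow_zero]
    gcongr
  have hsum := (t1.add (hinit (δ * α / 2) (by positivity))).add t3
  simp only [add_zero] at hsum
  exact tendsto_of_tendsto_of_tendsto_of_le_of_le' tendsto_const_nhds hsum
    (Eventually.of_forall fun _ => zero_le) hbound

end Asymptotics

end LaplaceMixture

theorem theorem2
    -- numbers of clusters and dimensions, as functions of the sample size `n`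
    (k d : ℕ → ℕ) (hk : ∀ n, 2 ≤ k n) (hd : ∀ n, 1 ≤ d n)
    -- true labels, locations, and scales bounded away from `0` and `∞`
    (z : ∀ n, Fin n → Fin (k n))
    (μ σ : ∀ n, Fin (k n) → Fin (d n) → ℝ)
    (σmin σmax : ℝ) (hσmin : 0 < σmin)
    (hσ : ∀ n a l, σmin ≤ σ n a l ∧ σ n a l ≤ σmax)
    -- the data
    {Ω : ℕ → Type*} [∀ n, MeasurableSpace (Ω n)]
    (P : ∀ n, Measure (Ω n)) [∀ n, IsProbabilityMeasure (P n)]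
    (X : ∀ n, Ω n → Fin n → Fin (d n) → ℝ)
    (hX : ∀ n, LaplaceMixture.IsLaplaceMixture (P n) (z n) (μ n) (σ n) (X n))
    -- `k log²(dk) = o(n)`, and balanced clusters
    (hkd : (fun n => (k n : ℝ) * Real.log ((d n : ℝ) * (k n : ℝ)) ^ 2)
      =o[atTop] fun n => (n : ℝ))
    (α : ℝ) (hα : 0 < α)
    (hbal : ∀ᶠ n : ℕ in atTop, ∀ a, α * ((n : ℝ) / (k n : ℝ)) ≤
      (LaplaceMixture.clusterSize (z n) a : ℝ))
    -- `Δ = O(Chernoff / d)` and `Chernoff = ω(d √k (1 + Δ / √(n/k)))`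
    (hΔ : (fun n => LaplaceMixture.maxSep (μ n))
      =O[atTop] fun n => (d n : ℝ)⁻¹ * LaplaceMixture.chernoffFamily (μ n) (σ n))
    (hC : (fun n => (d n : ℝ) * √(k n : ℝ) *
        (1 + LaplaceMixture.maxSep (μ n) / √((n : ℝ) / (k n : ℝ))))
      =o[atTop] fun n => LaplaceMixture.chernoffFamily (μ n) (σ n))
    -- a run of the algorithm; the initialisation may depend on the data
    (zhat : ∀ n, Ω n → ℕ → Fin n → Fin (k n))
    (hrun : ∀ n ω, LaplaceMixture.IsRun (X n ω) (zhat n ω))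
    -- the loss of the initialisation is `o(n k⁻¹ Δ⁻¹)` in probability
    (hinit : ∀ η : ℝ, 0 < η → Tendsto (fun n => P n {ω |
      η * ((n : ℝ) * (k n : ℝ)⁻¹ * (LaplaceMixture.maxSep (μ n))⁻¹) <
        (LaplaceMixture.loss (z n) (zhat n ω 0) : ℝ)}) atTop (𝓝 0))
    (c : ℝ) (hc : 0 < c) :
    ∃ ε : ℕ → ℝ, Tendsto ε atTop (𝓝 0) ∧
      Tendsto (fun n => P n {ω | ¬ ∀ t : ℕ, ⌊c * Real.log (n : ℝ)⌋₊ ≤ t →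
        (n : ℝ)⁻¹ * (LaplaceMixture.loss (z n) (zhat n ω t) : ℝ) ≤
          Real.exp (-(1 + ε n) * LaplaceMixture.chernoffFamily (μ n) (σ n))}) atTop (𝓝 0) := by
  have hlim := fun η (hη : 0 < η) (hη' : η ≤ 1 / 2) =>
    LaplaceMixture.tendsto_measure_not_loss_le hk hd hσmin hσ hX hkd hα hbal hΔ hC hrun hinit
      hη hη'
  obtain ⟨η, hη, hlimη⟩ := exists_tendsto_diagonal (p := fun η n => P n {ω | ¬ ∀ t : ℕ, 1 ≤ t →
    (n : ℝ)⁻¹ * (LaplaceMixture.loss (z n) (zhat n ω t) : ℝ) ≤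
      Real.exp (-(1 - η) * LaplaceMixture.chernoffFamily (μ n) (σ n))}) one_half_pos hlim
  refine ⟨fun n => -η n, by simpa using hη.neg, ?_⟩
  -- The bound holds from the first iteration on, so it is enough that the prescribed starting time
  -- is eventually at least 1.
  have hlog : ∀ᶠ n : ℕ in atTop, 1 ≤ ⌊c * Real.log (n : ℝ)⌋₊ := by
    filter_upwards [((Real.tendsto_log_atTop.comp tendsto_natCast_atTop_atTop).const_mul_atTop
      hc).eventually_ge_atTop 1] with n hn
    exact (Nat.one_le_floor_iff _).2 hn
  refine tendsto_of_tendsto_of_tendsto_of_le_of_le' tendsto_const_nhds hlimη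
    (Eventually.of_forall fun _ => zero_le) ?_
  filter_upwards [hlog] with n hn
  refine measure_mono fun ω hω h => hω fun t ht => ?_
  simpa only [sub_eq_add_neg] using h t (hn.trans ht)
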